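/- By an analytic field we mean a field that is complete with respect to a (possibly trivial) non-archimedean real absolute value; an extension of analytic fields is assumed to preserve absolute values. For an extension $L/K$ of algebraically closed analytic fields and $S\subseteq L$ let $\widehat{K(S)^a}\subseteq L$ be the closure in $L$ of the field of all elements of $L$ algebraic over $K(S)$. The set $S$ is called topologically-algebraically independent over $K$ if $\widehat{K(S')^a}\subsetneq\widehat{K(S)^a}$ for every $S'\subsetneq S$, and topologically-algebraically generating if $\widehat{K(S)^a}=L$. The topological transcendence degree $\mathrm{top.tr.deg}(L/K)$ is the supremum of the cardinals of all topologically-algebraically independent sets $S\subseteq L$; the topological generating degree of $L/K$ is the minimum of the cardinals of all topologically-algebraically generating sets; and $L/K$ is called small if its topological generating degree is finite. Theorem. Let $L/K$ be a small extension of algebraically closed analytic fields and let $K\subseteq F\subseteq L$ be an intermediate field that is an algebraically closed analytic field with respect to the absolute value of $L$. Then $\mathrm{top.tr.deg}(F/K)\le\mathrm{top.tr.deg}(L/K)$, and $F$ and $L$ are isomorphic as analytic $K$-fields (that is, there is an isomorphism of fields $F\to L$ which is the identity on $K$ and preserves absolute values) if and only if $\mathrm{top.tr.deg}(F/K)=\mathrm{top.tr.deg}(L/K)$.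 In addition, in this case the extension $L/F$ is immediate, that is, $|L^\times|=|F^\times|$ and the extension of residue fields $\widetilde L/\widetilde F$ is trivial. -/

import Mathlib

open Cardinal

noncomputable section

/-- For an algebraically closed analytic field `L` over `K` and `S ⊆ L`, the completed algebraic
closure of `K(S)`, taken inside `L`: the topological closure in `L` of the set of elements of `L`
that are algebraic over `K(S)`.  (As `L` is complete and algebraically closed, this is the
completion of an algebraic closure of `K(S)`.) -/
def taClosure (K : Type*) {L : Type*} [NormedField K] [NormedField L] [NormedAlgebra K L]
    (S : Set L) : Subfield L :=
  (algebraicClosure (IntermediateField.adjoin K S) L).toSubfield.topologicalClosure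

/-- `S` is topologically-algebraically independent over `K`: passing to a proper subset of `S`
always gives a strictly smaller completed algebraic closure. -/
def TAIndependent (K : Type*) {L : Type*} [NormedField K] [NormedField L] [NormedAlgebra K L]
    (S : Set L) : Prop :=
  ∀ S' : Set L, S' ⊂ S → taClosure K S' < taClosure K S

/-- `S` topologically-algebraically generates the algebraically closed analytic field `L`
over `K`. -/
def TAGenerating (K : Type*) {L : Type*} [NormedField K] [NormedField L] [NormedAlgebra K L]
    (S : Set L) : Prop :=
  taClosure K S = ⊤

universe u v

/-- The topological transcendence degree of `L/K`: the supremum of the cardinals of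
topologically-algebraically independent subsets (`L` algebraically closed).  The supremum is over
a set of cardinals bounded by the cardinal of `L`. -/
def topTrdeg (K : Type u) (L : Type v) [NormedField K] [NormedField L] [NormedAlgebra K L] :
    Cardinal.{v} :=
  ⨆ S : {S : Set L // TAIndependent K S}, #(S : Set L)

/-- The topological generating degree of `L/K`: the minimum of the cardinals of
topologically-algebraically generating subsets (`L` algebraically closed). -/
def topGenDeg (K : Type u) (L : Type v) [NormedField K] [NormedField L] [NormedAlgebra K L] :
    Cardinal.{v} :=
  ⨅ S : {S : Set L // TAGenerating K S}, #(S : Set L)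

/-- The extension `L/K` is small: its topological generating degree is finite. -/
def IsSmallExtension (K : Type u) (L : Type v) [NormedField K] [NormedField L]
    [NormedAlgebra K L] : Prop :=
  topGenDeg K L < ℵ₀

/-- `E` and `L` are isomorphic as analytic `K`-fields: there is a `K`-isomorphism of fields that
preserves the absolute values. -/
def AnalyticIsomorphic (K E L : Type*) [NormedField K] [NormedField E] [NormedField L]
    [NormedAlgebra K E] [NormedAlgebra K L] : Prop :=
  ∃ φ : E ≃ₐ[K] L, ∀ x : E, ‖φ x‖ = ‖x‖

/-- In an extension of non-archimedean normed fields, the valuation upstairs extends the one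
downstairs. -/
instance NormedField.hasExtension_valuation (E L : Type*) [NormedField E] [NormedField L]
    [IsUltrametricDist E] [IsUltrametricDist L] [NormedAlgebra E L] :
    (NormedField.valuation (K := E)).HasExtension (NormedField.valuation (K := L)) where
  val_isEquiv_comap := by
    intro x y
    simp

/-- The extension `L/E` is immediate: `|L^×| = |E^×|`, and the residue field extension is trivial,
i.e. the residue field of `E` maps onto that of `L`. -/
def IsImmediateExtension (E L : Type*) [NormedField E] [NormedField L]
    [IsUltrametricDist E] [IsUltrametricDist L] [NormedAlgebra E L] : Prop :=
  {r : ℝ | ∃ x : L, x ≠ 0 ∧ ‖x‖ = r} = {r : ℝ | ∃ x : E, x ≠ 0 ∧ ‖x‖ = r} ∧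
  Function.Bijective
    (algebraMap
      (IsLocalRing.ResidueField (NormedField.valuation (K := E)).valuationSubring)
      (IsLocalRing.ResidueField (NormedField.valuation (K := L)).valuationSubring))

/-- An intermediate field `F` of `L/K`, with the norm of `L`, as a normed algebra over `K`. -/
instance IntermediateField.normedAlgebraBot {K L : Type*} [NormedField K] [NormedField L]
    [NormedAlgebra K L] (F : IntermediateField K L) : NormedAlgebra K F :=
  { (inferInstance : Algebra K F) with
    norm_smul_le := fun a x => norm_smul_le a (x : L) }

/-- `L` as a normed algebra over an intermediate field `F` of `L/K`, with the norm of `L` on `F`. -/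
instance IntermediateField.normedAlgebraTop {K L : Type*} [NormedField K] [NormedField L]
    [NormedAlgebra K L] (F : IntermediateField K L) : NormedAlgebra F L :=
  { (inferInstance : Algebra F L) with
    norm_smul_le := fun a x => (norm_mul (a : L) x).le }

end

/-! Let `B` be the image of `K` in `L`, and let `tacl S` be the closure of `acl S`, the relative
algebraic closure of the subfield generated by `S`. Exchange is used only for `acl`, where it comes
from the matroid of algebraic independence; the passage to `tacl` is by approximation. If every `y
i` in a finite independent family is moved by less than its distance to `tacl` of `B` and the other
members, there is an isometric embedding of `tacl (B ∪ Set.range y)` that fixes `B` and realises the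
move (`exists_ringHom_tacl_family`). Independence therefore survives small moves, and members of
`tacl (B ∪ X)` may be replaced by elements of `acl (B ∪ X)`, where dimension can be counted. Hence
independent sets have at most `X.ncard` elements when `X` is a finite generating set, and a minimal
generating set attains this bound. As independence is preserved by isometric embeddings, the
inequality of degrees follows, and isomorphic fields have equal degrees.

Let `F` have the same degree `n` as `L`, so that it contains an independent family with `n` members.
No nonzero element of `L` is then orthogonal to `F`, that is, at least as far from all of `F` as
from 0 (`TAIndepFamily.exists_mem_norm_sub_lt`): an algebraic equation of such an element could be
perturbed to one over `F`, where the Gauss norm rules out the required cancellation. This is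
immediacy.

For the isomorphism, the same principle for one generator `x` shows that a strictly larger
intermediate field is strictly closer to `x` (`infDist_lt_of_notMem`). So a countable subset of `F`
that realises the distance to `x`, and suffices for the other generators, generates `F`. By
maximality of `n`, independent `n`-families in `F` can be moved slightly to capture any one
generator; Baire's theorem captures countably many at once. So `F` is generated by an independent
`n`-family, and moving that family to algebraic approximations over `B ∪ X` carries `F` onto `L`. -/

section

open Filter Topology Polynomial
open scoped IntermediateField

/-- A subfield of a field is relatively algebraically closed if it contains all roots of monic
polynomials with coefficients in it. -/
def Subfield.IsRelAlgClosed {L : Type*} [Field L] (M : Subfield L) : Prop :=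
  ∀ p : L[X], p.Monic → (∀ n, p.coeff n ∈ M) → ∀ x, p.eval x = 0 → x ∈ M

/-- The relative algebraic closure of the subfield generated by a set. -/
noncomputable def acl {L : Type*} [Field L] (S : Set L) : Subfield L :=
  (algebraicClosure (Subfield.closure S) L).toSubfield

/-! ### Relative algebraic closure, exchange and dimension counting. -/

section Algebraic

variable {L : Type*} [Field L]

theorem exists_monic_of_isAlgebraic {M : Subfield L} {x : L} (hx : IsAlgebraic M x) :
    ∃ p : L[X], p.Monic ∧ (∀ n, p.coeff n ∈ M) ∧ p.eval x = 0 := by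
  obtain ⟨q, hq, hqx⟩ := hx.isIntegral
  refine ⟨q.map M.subtype, hq.map _, fun n => ?_, ?_⟩
  · rw [coeff_map]; exact (q.coeff n).2
  · rw [eval_map]; exact hqx

theorem isAlgebraic_of_monic {M : Subfield L} {x : L} {p : L[X]} (hp : p.Monic)
    (hpM : ∀ n, p.coeff n ∈ M) (hx : p.eval x = 0) : IsAlgebraic M x := by
  obtain ⟨q, hq⟩ : p ∈ Polynomial.lifts M.subtype :=
    (Polynomial.lifts_iff_coeff_lifts p).2 fun n => ⟨⟨_, hpM n⟩, rfl⟩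
  refine ⟨q, ?_, ?_⟩
  · rintro rfl
    simp only [coe_mapRingHom, Polynomial.map_zero] at hq
    exact hp.ne_zero hq.symm
  · rw [← hq] at hx
    rwa [coe_mapRingHom, eval_map] at hx

theorem Subfield.IsRelAlgClosed.mem_of_isAlgebraic {M : Subfield L} (hM : M.IsRelAlgClosed)
    {x : L} (hx : IsAlgebraic M x) : x ∈ M := by
  obtain ⟨p, h1, h2, h3⟩ := exists_monic_of_isAlgebraic hx
  exact hM p h1 h2 x h3

theorem mem_acl {S : Set L} {x : L} : x ∈ acl S ↔ IsAlgebraic (Subfield.closure S) x :=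
  mem_algebraicClosure_iff

theorem closure_le_acl (S : Set L) : Subfield.closure S ≤ acl S := fun x hx =>
  mem_acl.2 (isAlgebraic_algebraMap (⟨x, hx⟩ : Subfield.closure S))

theorem subset_acl (S : Set L) : S ⊆ acl S := fun _ hx =>
  closure_le_acl S (Subfield.subset_closure hx)

theorem isRelAlgClosed_acl (S : Set L) : (acl S).IsRelAlgClosed := by
  intro p hp hpM x hx
  have h : IsAlgebraic (algebraicClosure (Subfield.closure S) L) x :=
    isAlgebraic_of_monic (M := acl S) hp hpM hx
  exact mem_acl.2 (h.restrictScalars _)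

theorem acl_le {S : Set L} {M : Subfield L} (hM : M.IsRelAlgClosed) (h : S ⊆ M) :
    acl S ≤ M := by
  intro x hx
  obtain ⟨p, h1, h2, h3⟩ := exists_monic_of_isAlgebraic (mem_acl.1 hx)
  exact hM p h1 (fun n => Subfield.closure_le.2 h (h2 n)) x h3

theorem acl_mono {S T : Set L} (h : S ⊆ T) : acl S ≤ acl T :=
  acl_le (isRelAlgClosed_acl T) (h.trans (subset_acl T))

theorem Subfield.IsRelAlgClosed.isAlgClosed [IsAlgClosed L] {M : Subfield L}
    (hM : M.IsRelAlgClosed) : IsAlgClosed M := by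
  refine IsAlgClosed.of_exists_root M fun p hp hirr => ?_
  have hd : (p.map M.subtype).degree ≠ 0 := by
    rw [degree_map]; exact hirr.degree_pos.ne'
  obtain ⟨x, hx⟩ := IsAlgClosed.exists_root _ hd
  have hxM : x ∈ M := hM _ (hp.map _) (fun n => by rw [coeff_map]; exact (p.coeff n).2) x hx
  refine ⟨⟨x, hxM⟩, ?_⟩
  have : M.subtype (p.eval ⟨x, hxM⟩) = 0 := by
    rw [IsRoot.def, eval_map] at hx
    rw [← hx, ← eval₂_at_apply]; rfl
  exact Subtype.ext this

theorem Subfield.isRelAlgClosed_of_isAlgClosed {M : Subfield L} [IsAlgClosed M] :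
    M.IsRelAlgClosed := by
  intro p hp hpM x hx
  obtain ⟨q, hq⟩ : p ∈ Polynomial.lifts M.subtype :=
    (Polynomial.lifts_iff_coeff_lifts p).2 fun n => ⟨⟨_, hpM n⟩, rfl⟩
  rw [coe_mapRingHom] at hq
  have hq0 : q ≠ 0 := by
    rintro rfl
    exact hp.ne_zero (by rw [← hq, Polynomial.map_zero])
  obtain ⟨y, rfl⟩ := (IsAlgClosed.splits q).mem_range_of_isRoot hq0 (i := M.subtype) (x := x)
    (by rw [hq]; exact hx)
  exact y.2

theorem exists_finite_mem_closure {S T : Set L} {x : L} (hx : x ∈ Subfield.closure (S ∪ T)) :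
    ∃ C : Set L, C.Finite ∧ C ⊆ S ∧ x ∈ Subfield.closure (C ∪ T) := by
  have mono {C D : Set L} (h : C ⊆ D) : Subfield.closure (C ∪ T) ≤ Subfield.closure (D ∪ T) :=
    Subfield.closure_mono (Set.union_subset_union_left T h)
  induction hx using Subfield.closure_induction with
  | mem x hx =>
    rcases hx with hx | hx
    · exact ⟨{x}, Set.finite_singleton x, Set.singleton_subset_iff.2 hx,
        Subfield.subset_closure (Or.inl rfl)⟩
    · exact ⟨∅, Set.finite_empty, Set.empty_subset _, Subfield.subset_closure (Or.inr hx)⟩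
  | one => exact ⟨∅, Set.finite_empty, Set.empty_subset _, one_mem _⟩
  | add x y _ _ hx hy =>
    obtain ⟨C, h1, h2, h3⟩ := hx
    obtain ⟨D, h4, h5, h6⟩ := hy
    exact ⟨C ∪ D, h1.union h4, Set.union_subset h2 h5,
      add_mem (mono Set.subset_union_left h3) (mono Set.subset_union_right h6)⟩
  | neg x _ hx =>
    obtain ⟨C, h1, h2, h3⟩ := hx
    exact ⟨C, h1, h2, neg_mem h3⟩
  | inv x _ hx =>
    obtain ⟨C, h1, h2, h3⟩ := hx
    exact ⟨C, h1, h2, inv_mem h3⟩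
  | mul x y _ _ hx hy =>
    obtain ⟨C, h1, h2, h3⟩ := hx
    obtain ⟨D, h4, h5, h6⟩ := hy
    exact ⟨C ∪ D, h1.union h4, Set.union_subset h2 h5,
      mul_mem (mono Set.subset_union_left h3) (mono Set.subset_union_right h6)⟩

/-- An element algebraic over `S ∪ T` is algebraic over `C ∪ T` for a finite `C ⊆ S`. -/
theorem exists_finite_mem_acl {S T : Set L} {x : L} (hx : x ∈ acl (S ∪ T)) :
    ∃ C : Set L, C.Finite ∧ C ⊆ S ∧ x ∈ acl (C ∪ T) := by
  obtain ⟨p, h1, h2, h3⟩ := exists_monic_of_isAlgebraic (mem_acl.1 hx)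
  choose C hC1 hC2 hC3 using fun n => exists_finite_mem_closure (h2 n)
  refine ⟨⋃ n ∈ Finset.range (p.natDegree + 1), C n, ?_, ?_, ?_⟩
  · exact (Finset.range _).finite_toSet.biUnion fun n _ => hC1 n
  · exact Set.iUnion₂_subset fun n _ => hC2 n
  · refine mem_acl.2 (isAlgebraic_of_monic h1 (fun n => ?_) h3)
    by_cases hn : n ≤ p.natDegree
    · refine Subfield.closure_mono (Set.union_subset_union_left T ?_) (hC3 n)
      exact Set.subset_biUnion_of_mem (u := C)
        (Finset.mem_coe.2 (by simpa using Nat.lt_succ_of_le hn))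
    · rw [coeff_eq_zero_of_natDegree_lt (not_le.1 hn)]
      exact zero_mem _

-- This is the bridge to the matroid of algebraic independence over the field generated by `B`, from
-- which exchange and rank bounds are drawn.
open scoped IntermediateField.algebraAdjoinAdjoin in
theorem coe_acl_union_eq_matroid_closure (B S : Set L) :
    (acl (B ∪ S) : Set L) =
      (AlgebraicIndependent.matroid (Subfield.closure B) L).closure S := by
  rw [AlgebraicIndependent.matroid_closure_eq]
  have h : acl (B ∪ S) = acl (Set.range (algebraMap (Subfield.closure B) L) ∪ S) := by
    apply le_antisymm
    · refine acl_mono (Set.union_subset_union_left S fun b hb => ?_)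
      exact ⟨⟨b, Subfield.subset_closure hb⟩, rfl⟩
    · refine acl_le (isRelAlgClosed_acl _) (Set.union_subset ?_ ?_)
      · rintro _ ⟨b, rfl⟩
        exact closure_le_acl _ (Subfield.closure_mono Set.subset_union_left b.2)
      · exact Set.subset_union_right.trans (subset_acl _)
  rw [h]
  ext x
  rw [SetLike.mem_coe, mem_acl]
  exact (IsFractionRing.isAlgebraic_iff (Algebra.adjoin (Subfield.closure B) S)
    (IntermediateField.adjoin (Subfield.closure B) S) L).symm

/-- The exchange property of algebraic closure. -/
theorem mem_acl_exchange {S : Set L} {g x : L} (h : g ∈ acl (insert x S)) (h' : g ∉ acl S) :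
    x ∈ acl (insert g S) := by
  rw [← Set.empty_union (insert g S), ← SetLike.mem_coe, coe_acl_union_eq_matroid_closure]
  rw [← Set.empty_union (insert x S), ← SetLike.mem_coe, coe_acl_union_eq_matroid_closure] at h
  rw [← Set.empty_union S, ← SetLike.mem_coe, coe_acl_union_eq_matroid_closure] at h'
  exact Matroid.mem_closure_insert h' h

open AlgebraicIndependent in
theorem indep_range_of_notMem_acl {ι : Type*} {B : Set L} {y : ι → L}
    (hy : ∀ i, y i ∉ acl (B ∪ y '' {i}ᶜ)) :
    (matroid (Subfield.closure B) L).Indep (Set.range y) ∧ Function.Injective y := by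
  have hinj : Function.Injective y := by
    intro i j hij
    by_contra hne
    exact hy i (subset_acl _ (Or.inr ⟨j, fun h => hne h.symm, hij.symm⟩))
  refine ⟨?_, hinj⟩
  rw [Matroid.indep_iff_forall_notMem_closure_sdiff]
  rintro _ ⟨i, rfl⟩
  rw [← coe_acl_union_eq_matroid_closure]
  refine fun h => hy i ?_
  rw [SetLike.mem_coe] at h
  convert h using 3
  rw [← Set.image_univ, ← Set.image_singleton, ← Set.image_sdiff hinj, ← Set.compl_eq_univ_sdiff]

theorem card_le_of_mem_acl {ι : Type*} [Fintype ι] {B X : Set L} (hX : X.Finite) {y : ι → L}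
    (hy : ∀ i, y i ∉ acl (B ∪ y '' {i}ᶜ)) (hyX : ∀ i, y i ∈ acl (B ∪ X)) :
    Fintype.card ι ≤ X.ncard := by
  obtain ⟨hI, hinj⟩ := indep_range_of_notMem_acl hy
  have h1 := hI.encard_le_eRk_of_subset (X := (acl (B ∪ X) : Set L))
    (by rintro _ ⟨i, rfl⟩; exact hyX i)
  rw [coe_acl_union_eq_matroid_closure, Matroid.eRk_closure_eq] at h1
  have h2 := h1.trans (Matroid.eRk_le_encard _ X)
  rw [← hX.cast_ncard_eq, ← Set.image_univ, hinj.encard_image, Set.encard_univ,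
    ENat.card_eq_coe_fintype_card] at h2
  exact_mod_cast h2

/-- By exchange, an element of `X` not algebraic over `B` and `y` could be adjoined to `y`, giving
an independent family longer than the rank bound `X.ncard` allows. -/
theorem subset_acl_of_card_eq {ι : Type*} [Fintype ι] {B X : Set L} (hX : X.Finite) {y : ι → L}
    (hy : ∀ i, y i ∉ acl (B ∪ y '' {i}ᶜ)) (hyX : ∀ i, y i ∈ acl (B ∪ X))
    (hcard : Fintype.card ι = X.ncard) : X ⊆ acl (B ∪ Set.range y) := by
  intro x hx
  by_contra hxy
  let z : Option ι → L := fun o => o.elim x y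
  have hz : ∀ o, z o ∉ acl (B ∪ z '' {o}ᶜ) := by
    rintro (_ | i)
    · intro h
      refine hxy (acl_mono (Set.union_subset_union_right B ?_) h)
      rintro _ ⟨_ | j, hj, rfl⟩
      · exact absurd rfl hj
      · exact ⟨j, rfl⟩
    · intro h
      have h1 : y i ∈ acl (insert x (B ∪ y '' {i}ᶜ)) := by
        refine acl_mono ?_ h
        rintro _ (hb | ⟨_ | j, hj, rfl⟩)
        · exact Or.inr (Or.inl hb)
        · exact Or.inl rfl
        · exact Or.inr (Or.inr ⟨j, fun h => hj (by rw [Set.mem_singleton_iff.1 h]; rfl), rfl⟩)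
      refine hxy (acl_mono ?_ (mem_acl_exchange h1 (hy i)))
      rintro _ (rfl | hb | ⟨j, _, rfl⟩)
      · exact Or.inr ⟨i, rfl⟩
      · exact Or.inl hb
      · exact Or.inr ⟨j, rfl⟩
  have := card_le_of_mem_acl hX hz (by
    rintro (_ | i)
    · exact subset_acl _ (Or.inr hx)
    · exact hyX i)
  rw [Fintype.card_option] at this
  omega

end Algebraic

/-! ### Lower limits of subfields, continuity of roots, completed algebraic closures. -/

section Closure

variable {L : Type*} [NormedField L]

/-- The inferior limit of a family of subfields of a normed field along a filter: the elements
all of whose neighbourhoods eventually meet the subfields of the family. -/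
def Subfield.limInf {α : Type*} (l : Filter α) (G : α → Subfield L) : Subfield L where
  carrier := {a | ∀ U ∈ 𝓝 a, ∀ᶠ i in l, ∃ b ∈ G i, b ∈ U}
  mul_mem' {a b} ha hb U hU := by
    have h : Tendsto (fun p : L × L => p.1 * p.2) (𝓝 a ×ˢ 𝓝 b) (𝓝 (a * b)) := by
      rw [← nhds_prod_eq]; exact tendsto_mul
    obtain ⟨V, hV, W, hW, hVW⟩ := Filter.mem_prod_iff.1 (h hU)
    filter_upwards [ha V hV, hb W hW] with i hi hj
    obtain ⟨c, hc, hcV⟩ := hi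
    obtain ⟨d, hd, hdW⟩ := hj
    exact ⟨c * d, mul_mem hc hd, @hVW (c, d) ⟨hcV, hdW⟩⟩
  add_mem' {a b} ha hb U hU := by
    have h : Tendsto (fun p : L × L => p.1 + p.2) (𝓝 a ×ˢ 𝓝 b) (𝓝 (a + b)) := by
      rw [← nhds_prod_eq]; exact tendsto_add
    obtain ⟨V, hV, W, hW, hVW⟩ := Filter.mem_prod_iff.1 (h hU)
    filter_upwards [ha V hV, hb W hW] with i hi hj
    obtain ⟨c, hc, hcV⟩ := hi
    obtain ⟨d, hd, hdW⟩ := hj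
    exact ⟨c + d, add_mem hc hd, @hVW (c, d) ⟨hcV, hdW⟩⟩
  one_mem' U hU := Eventually.of_forall fun i => ⟨1, one_mem _, mem_of_mem_nhds hU⟩
  zero_mem' U hU := Eventually.of_forall fun i => ⟨0, zero_mem _, mem_of_mem_nhds hU⟩
  neg_mem' {a} ha U hU := by
    have h : Tendsto (fun x : L => -x) (𝓝 a) (𝓝 (-a)) := tendsto_id.neg
    filter_upwards [ha _ (h hU)] with i hi
    obtain ⟨c, hc, hcV⟩ := hi
    exact ⟨-c, neg_mem hc, hcV⟩
  inv_mem' a ha U hU := by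
    rcases eq_or_ne a 0 with rfl | h0
    · rw [inv_zero] at hU
      exact Eventually.of_forall fun i => ⟨0, zero_mem _, mem_of_mem_nhds hU⟩
    have h : Tendsto (fun x : L => x⁻¹) (𝓝 a) (𝓝 a⁻¹) := tendsto_inv₀ h0
    filter_upwards [ha _ (h hU)] with i hi
    obtain ⟨c, hc, hcV⟩ := hi
    exact ⟨c⁻¹, inv_mem hc, hcV⟩

namespace Subfield

variable {α : Type*} {l : Filter α} {G : α → Subfield L}

theorem mem_limInf {a : L} : a ∈ limInf l G ↔ ∀ U ∈ 𝓝 a, ∀ᶠ i in l, ∃ b ∈ G i, b ∈ U := Iff.rfl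

theorem isClosed_limInf : IsClosed (limInf l G : Set L) := by
  refine isClosed_of_closure_subset fun a ha U hU => ?_
  obtain ⟨V, hVU, hV, haV⟩ := mem_nhds_iff.1 hU
  obtain ⟨b, hbV, hb⟩ := _root_.mem_closure_iff.1 ha V hV haV
  filter_upwards [hb V (hV.mem_nhds hbV)] with i hi
  obtain ⟨c, hc, hcV⟩ := hi
  exact ⟨c, hc, hVU hcV⟩

/-- Continuity of roots. -/
theorem isRelAlgClosed_limInf [IsAlgClosed L] (hG : ∀ i, (G i).IsRelAlgClosed) :
    (limInf l G).IsRelAlgClosed := by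
  intro p hp hpM x hx U hU
  obtain ⟨ε, hε, hεU⟩ := Metric.mem_nhds_iff.1 hU
  set d := p.natDegree with hd
  have hev (b : Fin d → L) (y : L) :
      (X ^ d + ∑ k, C (b k) * X ^ (k : ℕ) : L[X]).eval y = y ^ d + ∑ k, b k * y ^ (k : ℕ) := by
    simp [eval_finsetSum]
  have hpe : p = X ^ d + ∑ k : Fin d, C (p.coeff k) * X ^ (k : ℕ) := by
    conv_lhs => rw [hp.as_sum]
    rw [Finset.sum_range]
  have hcont : Continuous fun b : Fin d → L => ‖x ^ d + ∑ k, b k * x ^ (k : ℕ)‖ := by fun_prop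
  have h0 : ‖x ^ d + ∑ k : Fin d, p.coeff k * x ^ (k : ℕ)‖ < ε ^ d := by
    rw [← hev (fun k => p.coeff k), ← hpe, hx, norm_zero]
    positivity
  have hnhds : {b : Fin d → L | ‖x ^ d + ∑ k, b k * x ^ (k : ℕ)‖ < ε ^ d} ∈
      𝓝 (fun k : Fin d => p.coeff k) :=
    (isOpen_lt hcont continuous_const).mem_nhds h0
  rw [nhds_pi, Filter.mem_pi'] at hnhds
  obtain ⟨I, t, ht, htI⟩ := hnhds
  have hall : ∀ᶠ i in l, ∀ k : Fin d, ∃ b ∈ G i, b ∈ t k :=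
    eventually_all.2 fun k => hpM k _ (ht k)
  filter_upwards [hall] with i hi
  choose b hbG hbt using hi
  have hb : ‖x ^ d + ∑ k, b k * x ^ (k : ℕ)‖ < ε ^ d := htI fun k _ => hbt k
  set q : L[X] := X ^ d + ∑ k, C (b k) * X ^ (k : ℕ) with hq
  have hlt : (∑ k, C (b k) * X ^ (k : ℕ) : L[X]).degree < d := by
    refine (degree_sum_le _ _).trans_lt ((Finset.sup_lt_iff (WithBot.bot_lt_coe d)).2 fun k _ => ?_)
    exact (degree_C_mul_X_pow_le _ _).trans_lt (WithBot.coe_lt_coe.2 (by exact_mod_cast k.2))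
  have hqm : q.Monic := monic_X_pow_add hlt
  have hqd : q.natDegree = d := by
    refine natDegree_eq_of_degree_eq_some ?_
    rw [hq, degree_add_eq_left_of_degree_lt (by rwa [degree_X_pow]), degree_X_pow]
  have hqG : ∀ n, q.coeff n ∈ G i := by
    intro n
    rw [hq, coeff_add, finsetSum_coeff, coeff_X_pow]
    refine add_mem (by split_ifs; exacts [one_mem _, zero_mem _]) (sum_mem fun k _ => ?_)
    rw [coeff_C_mul, coeff_X_pow]
    exact mul_mem (hbG k) (by split_ifs; exacts [one_mem _, zero_mem _])
  have hsplit := IsAlgClosed.splits q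
  rw [← hev, ← hq, hsplit.eval_eq_prod_roots_of_monic hqm] at hb
  -- All roots of `q` lie in `G i`. If none were in `U`, each would be at distance at least `ε` from
  -- `x`, so their product would give `‖q(x)‖ ≥ ε ^ d`, against the choice of the coefficients `b`.
  by_contra hcon
  push Not at hcon
  have hroot : ∀ β ∈ q.roots, ε ≤ ‖x - β‖ := by
    intro β hβ
    have hβ' : β ∈ G i := hG i q hqm hqG β (isRoot_of_mem_roots hβ)
    by_contra hlt
    refine hcon β hβ' (hεU ?_)
    rw [Metric.mem_ball, dist_comm, dist_eq_norm]
    exact not_le.1 hlt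
  have hprod : ‖(q.roots.map fun β => x - β).prod‖ = (q.roots.map fun β => ‖x - β‖).prod := by
    rw [← normHom_apply (α := L), map_multiset_prod, Multiset.map_map]
    rfl
  rw [hprod] at hb
  have := Multiset.prod_map_le_prod_map₀ (s := q.roots) (fun _ => ε) (fun β => ‖x - β‖)
    (fun _ _ => hε.le) hroot
  rw [Multiset.map_const', Multiset.prod_replicate, ← hsplit.natDegree_eq_card_roots, hqd] at this
  exact absurd hb (not_lt.2 this)

/-- A closure is the lower limit of a constant family, so continuity of roots also shows that
closures of relatively algebraically closed subfields are relatively algebraically closed. -/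
theorem topologicalClosure_eq_limInf (M : Subfield L) :
    M.topologicalClosure = limInf (pure ()) fun _ => M := by
  ext a
  change a ∈ _root_.closure (M : Set L) ↔ _
  rw [mem_closure_iff_nhds, mem_limInf]
  refine forall₂_congr fun U hU => ?_
  rw [eventually_pure]
  exact ⟨fun ⟨b, h1, h2⟩ => ⟨b, h2, h1⟩, fun ⟨b, h1, h2⟩ => ⟨b, h2, h1⟩⟩

theorem IsRelAlgClosed.topologicalClosure [IsAlgClosed L] {M : Subfield L}
    (hM : M.IsRelAlgClosed) : M.topologicalClosure.IsRelAlgClosed := by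
  rw [topologicalClosure_eq_limInf]
  exact isRelAlgClosed_limInf fun _ => hM

end Subfield

/-- The completed algebraic closure, inside a complete algebraically closed field, of the
subfield generated by a set. -/
noncomputable def tacl (S : Set L) : Subfield L := (acl S).topologicalClosure

theorem taClosure_eq_tacl (K : Type*) [NormedField K] [NormedAlgebra K L] (S : Set L) :
    taClosure K S = tacl (Set.range (algebraMap K L) ∪ S) := rfl

theorem isClosed_tacl (S : Set L) : IsClosed (tacl S : Set L) :=
  Subfield.isClosed_topologicalClosure _

theorem isRelAlgClosed_tacl [IsAlgClosed L] (S : Set L) : (tacl S).IsRelAlgClosed :=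
  (isRelAlgClosed_acl S).topologicalClosure

theorem acl_le_tacl (S : Set L) : acl S ≤ tacl S := Subfield.le_topologicalClosure _

theorem subset_tacl (S : Set L) : S ⊆ tacl S := (subset_acl S).trans (acl_le_tacl S)

theorem tacl_le {S : Set L} {M : Subfield L} (hc : IsClosed (M : Set L)) (hM : M.IsRelAlgClosed)
    (h : S ⊆ M) : tacl S ≤ M :=
  Subfield.topologicalClosure_minimal _ (acl_le hM h) hc

theorem tacl_mono {S T : Set L} (h : S ⊆ T) : tacl S ≤ tacl T :=
  Subfield.topologicalClosure_minimal _ ((acl_mono h).trans (acl_le_tacl T)) (isClosed_tacl T)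

theorem tacl_le_tacl [IsAlgClosed L] {S T : Set L} (h : S ⊆ tacl T) : tacl S ≤ tacl T :=
  tacl_le (isClosed_tacl T) (isRelAlgClosed_tacl T) h

theorem tacl_eq_self {M : Subfield L} (hc : IsClosed (M : Set L)) (hM : M.IsRelAlgClosed) :
    tacl (M : Set L) = M :=
  le_antisymm (tacl_le hc hM subset_rfl) (subset_tacl _)

theorem tacl_tacl_union [IsAlgClosed L] (S T : Set L) : tacl (tacl S ∪ T) = tacl (S ∪ T) := by
  apply le_antisymm
  · refine tacl_le_tacl (Set.union_subset (tacl_mono Set.subset_union_left) ?_)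
    exact Set.subset_union_right.trans (subset_tacl _)
  · exact tacl_mono (Set.union_subset_union_left T (subset_tacl S))

/-- Elements of the completed algebraic closure are limits of algebraic elements. -/
theorem exists_mem_acl_norm_sub_lt {S : Set L} {x : L} (hx : x ∈ tacl S) {ε : ℝ} (hε : 0 < ε) :
    ∃ g ∈ acl S, ‖x - g‖ < ε := by
  obtain ⟨g, hg, hxg⟩ := Metric.mem_closure_iff.1 (show x ∈ closure (acl S : Set L) from hx) ε hε
  exact ⟨g, hg, by rwa [← dist_eq_norm]⟩

end Closure

/-! ### Transport of completed algebraic closures along isometric embeddings. -/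

section Map

variable {L₁ L₂ : Type*} [NormedField L₁] [NormedField L₂] [CompleteSpace L₁]
  [IsAlgClosed L₁] [IsAlgClosed L₂]

theorem RingHom.isometry_of_norm {L₁ L₂ : Type*} [NormedField L₁] [NormedField L₂] {Φ : L₁ →+* L₂}
    (hΦ : ∀ x, ‖Φ x‖ = ‖x‖) : Isometry Φ := AddMonoidHomClass.isometry_of_norm Φ hΦ

/-- Norm preserving embeddings commute with completed algebraic closures. -/
theorem map_tacl {Φ : L₁ →+* L₂} (hΦ : ∀ x, ‖Φ x‖ = ‖x‖) (S : Set L₁) :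
    (tacl S).map Φ = tacl (Φ '' S) := by
  have hiso := RingHom.isometry_of_norm hΦ
  apply le_antisymm
  · rw [Subfield.map_le_iff_le_comap]
    refine tacl_le ?_ ?_ ?_
    · exact (isClosed_tacl (Φ '' S)).preimage hiso.continuous
    · intro p hp hpM x hx
      refine isRelAlgClosed_tacl _ (p.map Φ) (hp.map Φ) (fun n => ?_) (Φ x) ?_
      · rw [coeff_map]; exact hpM n
      · rw [eval_map, eval₂_at_apply, hx, map_zero]
    · intro x hx
      exact subset_tacl _ ⟨x, hx, rfl⟩
  · refine tacl_le ?_ ?_ ?_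
    · rw [Subfield.coe_map]
      exact hiso.isClosedEmbedding.isClosedMap _ (isClosed_tacl S)
    · intro p hp hpM x hx
      obtain ⟨q, hq⟩ : p ∈ Polynomial.lifts Φ := (Polynomial.lifts_iff_coeff_lifts p).2 fun n => by
        obtain ⟨y, _, hy⟩ := hpM n
        exact ⟨y, hy⟩
      rw [coe_mapRingHom] at hq
      have hqm : q.Monic := by
        rw [← hq] at hp
        exact monic_of_injective Φ.injective hp
      obtain ⟨y, rfl⟩ := (IsAlgClosed.splits q).mem_range_of_isRoot hqm.ne_zero (i := Φ) (x := x)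
        (by rw [hq]; exact hx)
      refine ⟨y, isRelAlgClosed_tacl S q hqm (fun n => ?_) y ?_, rfl⟩
      · obtain ⟨z, hz, hzn⟩ := hpM n
        rw [← hq, coeff_map] at hzn
        rwa [← Φ.injective hzn]
      · rw [← hq, eval_map, eval₂_at_apply] at hx
        exact (map_eq_zero Φ).1 hx
    · rintro _ ⟨x, hx, rfl⟩
      exact ⟨x, subset_tacl S hx, rfl⟩

end Map

/-! ### Extension of isometric embeddings to completed algebraic closures. -/

section Extension

/-- Over an ultrametric field, roots of monic polynomials with coefficients of norm at most one
have norm at most one. -/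
theorem norm_le_one_of_monic_root {N : Type*} [NormedField N] [IsUltrametricDist N] {p : N[X]}
    (hp : p.Monic) (hc : ∀ n, ‖p.coeff n‖ ≤ 1) {a : N} (ha : p.eval a = 0) : ‖a‖ ≤ 1 := by
  by_contra! h
  have hd : 0 < p.natDegree := by
    rcases Nat.eq_zero_or_pos p.natDegree with h0 | h0
    · rw [hp.natDegree_eq_zero.1 h0, eval_one] at ha
      exact absurd ha one_ne_zero
    · exact h0
  rw [hp.as_sum, eval_add, eval_pow, eval_X, eval_finsetSum] at ha
  have h1 : ‖a ^ p.natDegree‖ ≤ ‖a‖ ^ (p.natDegree - 1) := by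
    rw [eq_neg_of_add_eq_zero_left ha, norm_neg]
    refine IsUltrametricDist.norm_sum_le_of_forall_le_of_nonneg (by positivity) fun i hi => ?_
    rw [eval_mul, eval_C, eval_pow, eval_X, norm_mul, norm_pow]
    calc _ ≤ 1 * ‖a‖ ^ i := by gcongr; exact hc i
      _ ≤ _ := by
        rw [one_mul]
        exact pow_le_pow_right₀ h.le (by have := Finset.mem_range.1 hi; omega)
  rw [norm_pow] at h1
  exact absurd h1 (not_le.2 (pow_lt_pow_right₀ h (by omega)))

theorem norm_le_one_of_isAlgebraic {M A N : Type*} [Field M] [Field A] [Algebra M A]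
    [Algebra.IsAlgebraic M A] [NormedField N] [IsUltrametricDist N] {h : A →+* N}
    (hM : ∀ x : M, ‖h (algebraMap M A x)‖ ≤ 1) (y : A) : ‖h y‖ ≤ 1 := by
  obtain ⟨p, hp, hpy⟩ := (Algebra.IsAlgebraic.isAlgebraic (R := M) y).isIntegral
  refine norm_le_one_of_monic_root (p := p.map (h.comp (algebraMap M A))) (hp.map _)
    (fun n => by rw [coeff_map]; exact hM _) ?_
  rw [← Polynomial.map_map, eval_map, eval₂_at_apply, eval_map, hpy, map_zero]

/-- Uniqueness of extensions of the norm of a complete ultrametric field to algebraic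
extensions. -/
theorem norm_eq_of_isAlgebraic {M A N₁ N₂ : Type*} [NormedField M] [IsUltrametricDist M]
    [CompleteSpace M] [Field A] [Algebra M A] [Algebra.IsAlgebraic M A]
    [NormedField N₁] [IsUltrametricDist N₁] [NormedField N₂] [IsUltrametricDist N₂]
    {h₁ : A →+* N₁} {h₂ : A →+* N₂} (e₁ : ∀ x : M, ‖h₁ (algebraMap M A x)‖ = ‖x‖)
    (e₂ : ∀ x : M, ‖h₂ (algebraMap M A x)‖ = ‖x‖) (x : A) : ‖h₁ x‖ = ‖h₂ x‖ := by
  by_cases htriv : ∃ x : M, 1 < ‖x‖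
  · let _ : NontriviallyNormedField M :=
      { (inferInstance : NormedField M) with non_trivial := htriv }
    let v₁ : AbsoluteValue A ℝ := (NormedField.toAbsoluteValue N₁).comp h₁.injective
    let v₂ : AbsoluteValue A ℝ := (NormedField.toAbsoluteValue N₂).comp h₂.injective
    have w₁ : v₁ x = spectralNorm M A x := spectralNorm_unique_field_norm_ext e₁ x
    have w₂ : v₂ x = spectralNorm M A x := spectralNorm_unique_field_norm_ext e₂ x
    exact w₁.trans w₂.symm
  -- The spectral norm argument needs a nontrivial absolute value. For a trivial one, integrality
  -- bounds both norms of `x` and of `x⁻¹` by 1, so both norms of a nonzero `x` are 1.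
  · push Not at htriv
    have one {r : A → ℝ} (hr : ∀ y, r y ≤ 1) (hr' : ∀ y, r y⁻¹ = (r y)⁻¹) (h0 : 0 < r x) :
        r x = 1 :=
      le_antisymm (hr x) ((inv_le_one₀ h0).1 (hr' x ▸ hr x⁻¹))
    rcases eq_or_ne x 0 with rfl | hx
    · simp
    · rw [one (r := fun y => ‖h₁ y‖), one (r := fun y => ‖h₂ y‖)]
      · exact norm_le_one_of_isAlgebraic fun y => (e₂ y).le.trans (htriv y)
      · simp
      · exact norm_pos_iff.2 ((map_ne_zero h₂).2 hx)
      · exact norm_le_one_of_isAlgebraic fun y => (e₁ y).le.trans (htriv y)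
      · simp
      · exact norm_pos_iff.2 ((map_ne_zero h₁).2 hx)

theorem exists_ringHom_extension {M A N : Type*} [Field M] [Field A] [Algebra M A]
    [Algebra.IsAlgebraic M A] [Field N] [IsAlgClosed N] (f : M →+* N) :
    ∃ g : A →+* N, ∀ x, g (algebraMap M A x) = f x := by
  let _ : Algebra M N := f.toAlgebra
  exact ⟨(IsAlgClosed.lift : A →ₐ[M] N), (IsAlgClosed.lift : A →ₐ[M] N).commutes⟩

variable {L L' : Type*} [NormedField L] [NormedField L']

/-- Isometric embeddings of subfields extend to topological closures. -/
theorem exists_extension_topologicalClosure [CompleteSpace L'] {M : Subfield L} {f : M →+* L'}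
    (hf : ∀ x, ‖f x‖ = ‖x‖) :
    ∃ g : M.topologicalClosure →+* L', (∀ x, ‖g x‖ = ‖x‖) ∧
      ∀ x : M, g (Subfield.inclusion M.le_topologicalClosure x) = f x := by
  let i : M →+* M.topologicalClosure := Subfield.inclusion M.le_topologicalClosure
  have hi : Isometry i := RingHom.isometry_of_norm fun x => rfl
  have hd : DenseRange i := by
    intro x
    rw [Metric.mem_closure_iff]
    intro ε hε
    obtain ⟨b, hb, hxb⟩ := Metric.mem_closure_iff.1
      (show (x : L) ∈ closure (M : Set L) from x.2) ε hε
    exact ⟨i ⟨b, hb⟩, ⟨_, rfl⟩, hxb⟩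
  have hfi : Isometry f := RingHom.isometry_of_norm hf
  have hui := hi.isUniformInducing
  let g := IsDenseInducing.extendRingHom hui hd hfi.uniformContinuous
  have hg : ∀ x, g (i x) = f x := fun x =>
    IsDenseInducing.extend_eq (hui.isDenseInducing hd) hfi.continuous x
  have hgc : Continuous g :=
    (uniformContinuous_uniformly_extend hui hd hfi.uniformContinuous).continuous
  refine ⟨g, fun x => ?_, hg⟩
  refine hd.induction_on (p := fun x => ‖g x‖ = ‖x‖) x ?_ fun a => ?_
  · exact isClosed_eq hgc.norm continuous_norm
  · rw [hg, hf]; rfl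

/-- Isometric embeddings of complete subfields extend isometrically to algebraic closures. -/
theorem exists_extension_acl [IsUltrametricDist L] [CompleteSpace L] [IsUltrametricDist L']
    [IsAlgClosed L'] {M : Subfield L} (hM : IsClosed (M : Set L)) {f : M →+* L'}
    (hf : ∀ x, ‖f x‖ = ‖x‖) :
    ∃ g : algebraicClosure M L →+* L', (∀ x, ‖g x‖ = ‖x‖) ∧
      ∀ x : M, g (algebraMap M (algebraicClosure M L) x) = f x := by
  have : CompleteSpace M := hM.completeSpace_coe
  have : IsUltrametricDist M := ⟨fun x y z => dist_triangle_max (x : L) y z⟩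
  obtain ⟨g, hg⟩ := exists_ringHom_extension (A := algebraicClosure M L) f
  refine ⟨g, fun x => ?_, hg⟩
  exact norm_eq_of_isAlgebraic (h₁ := g) (h₂ := (algebraicClosure M L).val.toRingHom)
    (fun y => by rw [hg, hf]) (fun y => rfl) x

/-- Isometric embeddings of subfields extend to completed algebraic closures. -/
theorem exists_extension_tacl [CompleteSpace L'] [IsUltrametricDist L] [CompleteSpace L]
    [IsUltrametricDist L'] [IsAlgClosed L'] [IsAlgClosed L] {S : Set L} {M : Subfield L} (hM : S ⊆ M)
    {f : M →+* L'}
    (hf : ∀ x, ‖f x‖ = ‖x‖) :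
    ∃ g : tacl S →+* L', (∀ x, ‖g x‖ = ‖x‖) ∧
      ∀ x (hx : x ∈ M) (hx' : x ∈ tacl S), g ⟨x, hx'⟩ = f ⟨x, hx⟩ := by
  -- Complete, pass to the algebraic closure, complete again. The first completion is what makes the
  -- norm extend uniquely in the algebraic step.
  obtain ⟨g₁, hg₁, hgf₁⟩ := exists_extension_topologicalClosure hf
  obtain ⟨g₂, hg₂, hgf₂⟩ := exists_extension_acl (Subfield.isClosed_topologicalClosure M) hg₁
  obtain ⟨g₃, hg₃, hgf₃⟩ := exists_extension_topologicalClosure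
    (M := (algebraicClosure M.topologicalClosure L).toSubfield) (f := g₂) hg₂
  have hle : tacl S ≤ (algebraicClosure M.topologicalClosure L).toSubfield.topologicalClosure := by
    have h1 : acl (M.topologicalClosure : Set L) =
        (algebraicClosure M.topologicalClosure L).toSubfield := by
      ext x
      have h2 : Subfield.closure (M.topologicalClosure : Set L) = M.topologicalClosure :=
        Subfield.closure_eq _
      rw [mem_acl, h2]
      exact mem_algebraicClosure_iff.symm
    rw [← h1]
    exact tacl_mono (hM.trans M.le_topologicalClosure)
  refine ⟨g₃.comp (Subfield.inclusion hle), fun x => hg₃ _, fun x hx hx' => ?_⟩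
  rw [← hgf₁ ⟨x, hx⟩, ← hgf₂, ← hgf₃]
  rfl

end Extension

/-! ### Moving one element over an algebraically closed subfield. -/

section Perturbation

variable {L : Type*} [NormedField L] [IsUltrametricDist L]

/-- The relation `‖u - u'‖ < ‖u‖` means equality of leading terms. It forces equal norms, is
transitive and respects products and inverses, so it spreads from linear factors to rational
functions. -/
theorem norm_eq_of_norm_sub_lt {u u' : L} (h : ‖u - u'‖ < ‖u‖) : ‖u'‖ = ‖u‖ := by
  by_contra hne
  have := IsUltrametricDist.norm_add_eq_max_of_norm_ne_norm (x := u) (y := -u')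
    (by rw [norm_neg]; exact fun h => hne h.symm)
  rw [← sub_eq_add_neg, norm_neg] at this
  exact absurd h (not_lt.2 (this ▸ le_max_left _ _))

theorem norm_sub_lt_trans {u v w : L} (h : ‖u - v‖ < ‖u‖) (h' : ‖v - w‖ < ‖v‖) :
    ‖u - w‖ < ‖u‖ := by
  rw [norm_eq_of_norm_sub_lt h] at h'
  rw [← sub_add_sub_cancel u v w]
  exact (IsUltrametricDist.norm_add_le_max _ _).trans_lt (max_lt h h')

theorem norm_mul_sub_mul_lt {u u' v v' : L} (h : ‖u - u'‖ < ‖u‖) (h' : ‖v - v'‖ < ‖v‖) :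
    ‖u * v - u' * v'‖ < ‖u * v‖ := by
  have hu : 0 < ‖u‖ := (norm_nonneg _).trans_lt h
  have hv : 0 < ‖v‖ := (norm_nonneg _).trans_lt h'
  refine norm_sub_lt_trans (v := u * v') ?_ ?_
  · rw [← mul_sub, norm_mul, norm_mul]
    gcongr
  · rw [← sub_mul, norm_mul, norm_mul]
    have : 0 < ‖v'‖ := by rwa [norm_eq_of_norm_sub_lt h']
    gcongr

omit [IsUltrametricDist L] in
theorem ne_zero_of_norm_sub_lt {u u' : L} (h : ‖u - u'‖ < ‖u‖) : u ≠ 0 :=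
  norm_pos_iff.1 ((norm_nonneg _).trans_lt h)

theorem norm_inv_sub_inv_lt {u u' : L} (h : ‖u - u'‖ < ‖u‖) : ‖u⁻¹ - u'⁻¹‖ < ‖u⁻¹‖ := by
  have hu := ne_zero_of_norm_sub_lt h
  have hn := norm_eq_of_norm_sub_lt h
  have hu' : u' ≠ 0 := norm_ne_zero_iff.1 (hn ▸ norm_ne_zero_iff.2 hu)
  have hp : 0 < ‖u‖ := norm_pos_iff.2 hu
  rw [inv_sub_inv hu hu', norm_div, norm_mul, hn, norm_sub_rev, norm_inv,
    div_lt_iff₀ (by positivity)]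
  field_simp
  exact h

/-- Values of a polynomial at two points which are close to each other relative to the distance
to an algebraically closed field of coefficients. -/
theorem norm_aeval_sub_aeval_lt {E : Subfield L} [IsAlgClosed E] {y y' : L}
    (h : ∀ a ∈ E, ‖y - y'‖ < ‖y - a‖) {f : E[X]} (hf : f ≠ 0) :
    ‖aeval y f - aeval y' f‖ < ‖aeval y f‖ := by
  have hs := (IsAlgClosed.splits f).eq_prod_roots
  rw [hs, map_mul, map_mul, aeval_C, aeval_C]
  -- The constant factors agree, and the linear factors at `y` and `y'` differ by `y - y'`, which is
  -- smaller than `y - a` by hypothesis.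
  refine norm_mul_sub_mul_lt ?_ ?_
  · rw [sub_self, norm_zero, norm_pos_iff]
    exact (_root_.map_ne_zero _).2 (leadingCoeff_ne_zero.2 hf)
  · generalize f.roots = s
    induction s using Multiset.induction_on with
    | empty => simp
    | cons a s ih =>
      rw [Multiset.map_cons, Multiset.prod_cons, map_mul, map_mul]
      refine norm_mul_sub_mul_lt ?_ ih
      have := h a a.2
      simpa using! this

/-- A point can be moved over an algebraically closed subfield by less than its distance to that
subfield. -/
theorem exists_ringHom_tacl_insert [CompleteSpace L] [IsAlgClosed L] {E : Subfield L}
    (hE : E.IsRelAlgClosed) {y y' : L} (h : ∀ a ∈ E, ‖y - y'‖ < ‖y - a‖) :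
    ∃ Φ : tacl (insert y (E : Set L)) →+* L, (∀ x, ‖Φ x‖ = ‖x‖) ∧
      (∀ x : tacl (insert y (E : Set L)), (x : L) ∈ E → Φ x = x) ∧
      (∀ x : tacl (insert y (E : Set L)), (x : L) = y → Φ x = y') ∧
      ∀ x : tacl (insert y (E : Set L)), (x : L) ∈ Subfield.closure (insert y (E : Set L)) →
        x ≠ 0 → ‖(x : L) - Φ x‖ < ‖x‖ := by
  have := hE.isAlgClosed
  have hy : Transcendental E y := fun hy => by
    have := h y (hE.mem_of_isAlgebraic hy)
    rw [sub_self, norm_zero] at this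
    exact absurd this (not_lt.2 (norm_nonneg _))
  have hyy : ∀ f : E[X], f ≠ 0 → ‖aeval y f - aeval y' f‖ < ‖aeval y f‖ := fun f hf =>
    norm_aeval_sub_aeval_lt h hf
  have hy' : Transcendental E y' := by
    rintro ⟨p, hp, hpy⟩
    have := hyy p hp
    rw [hpy, sub_zero] at this
    exact lt_irrefl _ this
  -- Both points are transcendental over `E`, so `y ↦ y'` defines a map on `E(y)`; closeness of
  -- numerators and denominators makes it isometric.
  let e := RatFunc.algEquivOfTranscendental y hy
  let e' := RatFunc.algEquivOfTranscendental y' hy'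
  let f : E⟮y⟯ →ₐ[E] L := E⟮y'⟯.val.comp (e'.toAlgHom.comp e.symm.toAlgHom)
  have hfr (u : RatFunc E) : f (e u) = aeval y' u.num / aeval y' u.denom := by
    have : f (e u) = e' u := by simp [f]
    rw [this]
    exact RatFunc.algEquivOfTranscendental_apply y' hy' u
  have hnear (x : E⟮y⟯) (hx : x ≠ 0) : ‖(x : L) - f x‖ < ‖(x : L)‖ := by
    obtain ⟨u, rfl⟩ := e.surjective x
    have hu : u ≠ 0 := by rintro rfl; exact hx (map_zero e)
    rw [hfr, show ((e u : E⟮y⟯) : L) = aeval y u.num / aeval y u.denom from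
      RatFunc.algEquivOfTranscendental_apply y hy u, div_eq_mul_inv, div_eq_mul_inv]
    exact norm_mul_sub_mul_lt (hyy _ (RatFunc.num_ne_zero hu))
      (norm_inv_sub_inv_lt (hyy _ (RatFunc.denom_ne_zero u)))
  have hfn (x : E⟮y⟯) : ‖f x‖ = ‖(x : L)‖ := by
    rcases eq_or_ne x 0 with rfl | hx
    · simp
    · exact norm_eq_of_norm_sub_lt (hnear x hx)
  have hle : Subfield.closure (insert y (E : Set L)) ≤ E⟮y⟯.toSubfield := by
    refine Subfield.closure_le.2 (Set.insert_subset ?_ ?_)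
    · exact IntermediateField.mem_adjoin_simple_self E y
    · intro a ha
      exact E⟮y⟯.algebraMap_mem ⟨a, ha⟩
  obtain ⟨Φ, hΦ, hΦf⟩ := exists_extension_tacl (S := insert y (E : Set L)) (M := E⟮y⟯.toSubfield)
    (Subfield.closure_le.1 hle) (f := (f : E⟮y⟯ →+* L)) hfn
  refine ⟨Φ, hΦ, fun x hx => ?_, fun x hx => ?_, fun x hx hx0 => ?_⟩
  · have := hΦf x (E⟮y⟯.algebraMap_mem ⟨x, hx⟩) x.2
    exact this.trans (f.commutes ⟨x, hx⟩)
  · have h1 := hΦf x (by rw [hx]; exact IntermediateField.mem_adjoin_simple_self E y) x.2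
    refine h1.trans ?_
    have h2 := hfr RatFunc.X
    have h3 : (e RatFunc.X : L) = y := RatFunc.algEquivOfTranscendental_X y hy
    rw [RatFunc.num_X, RatFunc.denom_X, aeval_X, map_one, div_one] at h2
    rw [← h2]
    exact congrArg f (Subtype.ext (hx.trans h3.symm))
  · have h1 := hΦf x (hle hx) x.2
    have h2 := hnear ⟨x, hle hx⟩
      (fun h => hx0 (Subtype.ext (congrArg (fun z : E⟮y⟯ => (z : L)) h)))
    rw [show Φ x = f ⟨x, hle hx⟩ from h1]
    exact h2

end Perturbation

/-! ### Moving finite independent families, and approximation by algebraic elements. -/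

section Family

variable {L : Type*} [NormedField L] [IsUltrametricDist L] [CompleteSpace L] [IsAlgClosed L]

omit [IsUltrametricDist L] in
/-- The image of the completed algebraic closure of a family under a norm preserving embedding. -/
theorem map_tacl_family {ι : Type*} {B : Set L} {y y' : ι → L} {N : Subfield L}
    (hc : IsClosed (N : Set L)) (hN : N.IsRelAlgClosed) (hBN : B ∪ Set.range y ⊆ N)
    {Φ : N →+* L} (hΦ : ∀ x, ‖Φ x‖ = ‖x‖) (hΦB : ∀ x : N, (x : L) ∈ B → Φ x = x)
    (hΦy : ∀ i, ∀ x : N, (x : L) = y i → Φ x = y' i) (I : Set ι) :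
    (∀ x : N, (x : L) ∈ tacl (B ∪ y '' I) → Φ x ∈ tacl (B ∪ y' '' I)) ∧
    (∀ z ∈ tacl (B ∪ y' '' I), ∃ x : N, (x : L) ∈ tacl (B ∪ y '' I) ∧ Φ x = z) ∧
    (∀ x : N, (x : L) ∈ Subfield.closure (B ∪ y '' I) → Φ x ∈ Subfield.closure (B ∪ y' '' I)) ∧
    ∀ z ∈ Subfield.closure (B ∪ y' '' I), ∃ x : N, (x : L) ∈ Subfield.closure (B ∪ y '' I) ∧
      Φ x = z := by
  have : CompleteSpace N := hc.completeSpace_coe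
  have : IsAlgClosed N := hN.isAlgClosed
  let T : Set N := {x | (x : L) ∈ B ∪ y '' I}
  have hT : N.subtype '' T = B ∪ y '' I := by
    ext z
    constructor
    · rintro ⟨x, hx, rfl⟩
      exact hx
    · intro hz
      exact ⟨⟨z, hBN (Set.union_subset_union_right B (Set.image_subset_range y I) hz)⟩, hz, rfl⟩
  have hΦT : Φ '' T = B ∪ y' '' I := by
    ext z
    constructor
    · rintro ⟨x, hx | ⟨i, hi, hx⟩, rfl⟩
      · exact Or.inl (by rwa [hΦB x hx])
      · exact Or.inr ⟨i, hi, (hΦy i x hx.symm).symm⟩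
    · rintro (hz | ⟨i, hi, rfl⟩)
      · exact ⟨⟨z, hBN (Or.inl hz)⟩, Or.inl hz, hΦB _ hz⟩
      · exact ⟨⟨y i, hBN (Or.inr ⟨i, rfl⟩)⟩, Or.inr ⟨i, hi, rfl⟩, hΦy i _ rfl⟩
  have h1 : (tacl T).map N.subtype = tacl (B ∪ y '' I) := by
    rw [map_tacl (fun x => rfl), hT]
  have h2 : (tacl T).map Φ = tacl (B ∪ y' '' I) := by
    rw [map_tacl hΦ, hΦT]
  rw [← h1, ← h2]
  refine ⟨?_, ?_, ?_, ?_⟩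
  · rintro x ⟨z, hz, hzx⟩
    rw [← Subtype.ext hzx]
    exact ⟨z, hz, rfl⟩
  · rintro _ ⟨x, hx, rfl⟩
    exact ⟨x, ⟨x, hx, rfl⟩, rfl⟩
  · rw [← hT, ← hΦT, ← RingHom.map_field_closure, ← RingHom.map_field_closure]
    rintro x ⟨z, hz, hzx⟩
    rw [← Subtype.ext hzx]
    exact ⟨z, hz, rfl⟩
  · rw [← hT, ← hΦT, ← RingHom.map_field_closure, ← RingHom.map_field_closure]
    rintro _ ⟨x, hx, rfl⟩
    exact ⟨x, ⟨x, hx, rfl⟩, rfl⟩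

/-- All members of a family can be moved simultaneously by less than their distance to the
completed algebraic closure of the other members. -/
theorem exists_ringHom_tacl_family {ι : Type*} [Finite ι] {B : Set L} {y y' : ι → L}
    (h : ∀ i, ∀ a ∈ tacl (B ∪ y '' {i}ᶜ), ‖y i - y' i‖ < ‖y i - a‖) :
    ∃ Φ : tacl (B ∪ Set.range y) →+* L, (∀ x, ‖Φ x‖ = ‖x‖) ∧
      (∀ x : tacl (B ∪ Set.range y), (x : L) ∈ B → Φ x = x) ∧
      (∀ i, ∀ x : tacl (B ∪ Set.range y), (x : L) = y i → Φ x = y' i) ∧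
      ∀ x : tacl (B ∪ Set.range y), (x : L) ∈ Subfield.closure (B ∪ Set.range y) → x ≠ 0 →
        ‖(x : L) - Φ x‖ < ‖x‖ := by
  classical
  have := Fintype.ofFinite ι
  -- The members are moved one at a time; `s` is the set of those already moved.
  suffices H : ∀ s : Finset ι, ∃ Φ : tacl (B ∪ Set.range y) →+* L, (∀ x, ‖Φ x‖ = ‖x‖) ∧
      (∀ x : tacl (B ∪ Set.range y), (x : L) ∈ B → Φ x = x) ∧
      (∀ i, ∀ x : tacl (B ∪ Set.range y), (x : L) = y i → Φ x = s.piecewise y' y i) ∧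
      ∀ x : tacl (B ∪ Set.range y), (x : L) ∈ Subfield.closure (B ∪ Set.range y) → x ≠ 0 →
        ‖(x : L) - Φ x‖ < ‖x‖ by
    obtain ⟨Φ, h1, h2, h3, h4⟩ := H Finset.univ
    exact ⟨Φ, h1, h2, fun i x hx => by simpa using h3 i x hx, h4⟩
  intro s
  induction s using Finset.induction_on with
  | empty =>
    refine ⟨(tacl (B ∪ Set.range y)).subtype, fun x => rfl, fun x _ => rfl,
      fun i x hx => by simpa using hx, fun x _ hx => ?_⟩
    rw [Subfield.coe_subtype, sub_self, norm_zero]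
    exact norm_pos_iff.2 hx
  | insert j s hj ih =>
    obtain ⟨Φ, h1, h2, h3, h4⟩ := ih
    set z := s.piecewise y' y with hz
    have hmap (I : Set ι) := map_tacl_family (isClosed_tacl _) (isRelAlgClosed_tacl _)
      (subset_tacl _) h1 h2 h3 I
    have hzj : z j = y j := by simp [hz, hj]
    -- The isometry `Φ` sends `y j` to itself and the closure spanned by the other `y i` onto that
    -- of the other `z i`, so the room available for moving `y j` has not shrunk.
    have hEj : ∀ a ∈ tacl (B ∪ z '' {j}ᶜ), ‖z j - y' j‖ < ‖z j - a‖ := by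
      intro a ha
      obtain ⟨x, hx, rfl⟩ := (hmap _).2.1 a ha
      have hyj := h3 j ⟨y j, subset_tacl _ (Or.inr ⟨j, rfl⟩)⟩ rfl
      rw [hzj]
      refine (h j x hx).trans_eq ?_
      rw [← hzj, ← hyj, ← map_sub, h1]
      rw [hyj, hzj]
      rfl
    obtain ⟨Ψ, k1, k2, k3, k4⟩ := exists_ringHom_tacl_insert (isRelAlgClosed_tacl _) hEj
    have hsub : B ∪ Set.range z ⊆ insert (z j) (tacl (B ∪ z '' {j}ᶜ) : Set L) := by
      rintro _ (hb | ⟨i, rfl⟩)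
      · exact Or.inr (subset_tacl _ (Or.inl hb))
      · rcases eq_or_ne i j with rfl | hij
        · exact Or.inl rfl
        · exact Or.inr (subset_tacl _ (Or.inr ⟨i, hij, rfl⟩))
    have hmem (x) : Φ x ∈ tacl (insert (z j) (tacl (B ∪ z '' {j}ᶜ) : Set L)) := by
      have := (hmap Set.univ).1 x (by rw [Set.image_univ]; exact x.2)
      rw [Set.image_univ] at this
      exact tacl_mono hsub this
    refine ⟨Ψ.comp (Φ.codRestrict _ hmem), fun x => ?_, fun x hx => ?_, fun i x hx => ?_,
      fun x hx hx0 => ?_⟩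
    · exact (k1 _).trans (h1 x)
    · have hx2 := h2 x hx
      refine (k2 (Φ.codRestrict _ hmem x) ?_).trans hx2
      change Φ x ∈ _
      rw [hx2]
      exact subset_tacl _ (Or.inl hx)
    · have hx3 := h3 i x hx
      rcases eq_or_ne i j with rfl | hij
      · rw [Finset.piecewise_insert_self]
        exact k3 (Φ.codRestrict _ hmem x) hx3
      · rw [Finset.piecewise_insert, Function.update_of_ne hij]
        refine (k2 (Φ.codRestrict _ hmem x) ?_).trans hx3
        change Φ x ∈ _
        rw [hx3]
        exact subset_tacl _ (Or.inr ⟨i, hij, rfl⟩)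
    · refine norm_sub_lt_trans (h4 x hx hx0) ?_
      refine k4 (Φ.codRestrict _ hmem x) ?_ ?_
      · have := (hmap Set.univ).2.2.1 x (by rwa [Set.image_univ])
        rw [Set.image_univ] at this
        exact Subfield.closure_mono hsub this
      · exact (_root_.map_ne_zero _).2 hx0

/-- No member of the family belongs to the completed algebraic closure of the other ones. -/
def TAIndepFamily {ι : Type*} (B : Set L) (y : ι → L) : Prop :=
  ∀ i, y i ∉ tacl (B ∪ y '' {i}ᶜ)

omit [IsUltrametricDist L] [CompleteSpace L] [IsAlgClosed L] in
theorem exists_pos_le_norm_sub {M : Subfield L} (hc : IsClosed (M : Set L)) {z : L} (hz : z ∉ M) :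
    ∃ ε > 0, ∀ a ∈ M, ε ≤ ‖z - a‖ := by
  obtain ⟨ε, hε, hε'⟩ := Metric.mem_nhds_iff.1 (hc.isOpen_compl.mem_nhds hz)
  refine ⟨ε, hε, fun a ha => ?_⟩
  by_contra! hlt
  exact hε' (by rwa [Metric.mem_ball, dist_comm, dist_eq_norm]) ha

namespace TAIndepFamily

omit [IsUltrametricDist L] [CompleteSpace L] [IsAlgClosed L] in
theorem exists_pos {ι : Type*} [Finite ι] {B : Set L} {y : ι → L} (hy : TAIndepFamily B y) :
    ∃ δ > 0, ∀ y' : ι → L, (∀ i, ‖y i - y' i‖ < δ) →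
      ∀ i, ∀ a ∈ tacl (B ∪ y '' {i}ᶜ), ‖y i - y' i‖ < ‖y i - a‖ := by
  have h (i : ι) := exists_pos_le_norm_sub (isClosed_tacl _) (hy i)
  choose ε hε hε' using h
  rcases isEmpty_or_nonempty ι with hι | hι
  · exact ⟨1, one_pos, fun y' _ i => isEmptyElim i⟩
  · obtain ⟨j, hj⟩ := Finite.exists_min ε
    exact ⟨ε j, hε j, fun y' h' i a ha => (h' i).trans_le ((hj i).trans (hε' i a ha))⟩

/-- The moving isometry carries `y i`, and the closure spanned by the other members, to their
counterparts for `y'`; by injectivity a dependence of `y'` pulls back to one of `y`. -/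
theorem of_near {ι : Type*} [Finite ι] {B : Set L} {y y' : ι → L} (hy : TAIndepFamily B y)
    (h : ∀ i, ∀ a ∈ tacl (B ∪ y '' {i}ᶜ), ‖y i - y' i‖ < ‖y i - a‖) : TAIndepFamily B y' := by
  obtain ⟨Φ, h1, h2, h3, -⟩ := exists_ringHom_tacl_family h
  intro i hi
  obtain ⟨x, hx, hxi⟩ := (map_tacl_family (isClosed_tacl _) (isRelAlgClosed_tacl _)
    (subset_tacl _) h1 h2 h3 _).2.1 _ hi
  have hyi := h3 i ⟨y i, subset_tacl _ (Or.inr ⟨i, rfl⟩)⟩ rfl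
  rw [← hyi] at hxi
  rw [Φ.injective hxi] at hx
  exact hy i hx

omit [IsUltrametricDist L] [CompleteSpace L] [IsAlgClosed L] in
theorem notMem_acl {ι : Type*} {B : Set L} {y : ι → L} (hy : TAIndepFamily B y) (i : ι) :
    y i ∉ acl (B ∪ y '' {i}ᶜ) := fun h => hy i (acl_le_tacl _ h)

/-- A family of elements of `tacl (B ∪ X)` can be approximated by algebraic elements. -/
theorem exists_approx {ι : Type*} [Finite ι] {B S : Set L} {y : ι → L} (hy : TAIndepFamily B y)
    (hyS : ∀ i, y i ∈ tacl S) : ∃ y' : ι → L, (∀ i, y' i ∈ acl S) ∧ TAIndepFamily B y' ∧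
      ∀ i, ∀ a ∈ tacl (B ∪ y '' {i}ᶜ), ‖y i - y' i‖ < ‖y i - a‖ := by
  obtain ⟨δ, hδ, h⟩ := hy.exists_pos
  choose y' hy' hyy' using fun i => exists_mem_acl_norm_sub_lt (hyS i) hδ
  exact ⟨y', hy', hy.of_near (h y' hyy'), h y' hyy'⟩

/-- Independent approximations in `acl (B ∪ X)` reduce the bound to the algebraic count. -/
theorem card_le {ι : Type*} [Fintype ι] {B X : Set L} (hX : X.Finite) {y : ι → L}
    (hy : TAIndepFamily B y) (hyX : ∀ i, y i ∈ tacl (B ∪ X)) : Fintype.card ι ≤ X.ncard := by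
  obtain ⟨y', h1, h2, -⟩ := hy.exists_approx hyX
  exact card_le_of_mem_acl hX h2.notMem_acl h1

end TAIndepFamily

end Family

/-! ### Orthogonality and the Gauss norm. -/

section Immediate

variable {L : Type*} [NormedField L] [IsUltrametricDist L]

theorem norm_sub_le_max_of_ultrametric (x y : L) : ‖x - y‖ ≤ max ‖x‖ ‖y‖ := by
  rw [sub_eq_add_neg, ← norm_neg y]
  exact IsUltrametricDist.norm_add_le_max _ _

/-- If `z` is orthogonal to an algebraically closed subfield, then the norm of the value of a
polynomial at `z` is the Gauss norm. -/
theorem norm_coeff_mul_pow_le_norm_aeval {F : Subfield L} [IsAlgClosed F] {z : L}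
    (hz : ∀ u ∈ F, ‖z‖ ≤ ‖z - u‖) (f : F[X]) (n : ℕ) :
    ‖f.coeff n‖ * ‖z‖ ^ n ≤ ‖aeval z f‖ := by
  -- Induction over linear factors: orthogonality gives `‖z‖ ≤ ‖z - a‖`, hence also `‖a‖ ≤ ‖z - a‖`,
  -- so both terms of each new coefficient obey the bound.
  have key (s : Multiset F) (n : ℕ) : ‖((s.map fun a => X - C a).prod).coeff n‖ * ‖z‖ ^ n ≤
      ‖aeval z (s.map fun a => X - C a).prod‖ := by
    induction s using Multiset.induction_on generalizing n with
    | empty =>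
      simp only [Multiset.map_zero, Multiset.prod_zero, map_one, norm_one, coeff_one]
      split_ifs with h
      · simp [h]
      · simp
    | cons a s ih =>
      rw [Multiset.map_cons, Multiset.prod_cons, map_mul, norm_mul]
      set g := (s.map fun a => X - C a).prod
      have h1 : aeval z (X - C a) = z - a := by simp; rfl
      have hza := hz a a.2
      have ha : ‖a‖ ≤ ‖z - a‖ := by
        have := norm_sub_le_max_of_ultrametric z (z - a)
        rw [sub_sub_cancel, max_eq_right hza] at this
        exact this
      rw [h1, sub_mul, coeff_sub, coeff_C_mul]
      have hag : ‖a * g.coeff n‖ * ‖z‖ ^ n ≤ ‖z - a‖ * ‖aeval z g‖ := by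
        rw [norm_mul, mul_assoc]
        exact mul_le_mul ha (ih n) (by positivity) (by positivity)
      have hxg : ‖(X * g).coeff n‖ * ‖z‖ ^ n ≤ ‖z - a‖ * ‖aeval z g‖ := by
        cases n with
        | zero => simpa using by positivity
        | succ n =>
          rw [coeff_X_mul, pow_succ', mul_left_comm]
          exact mul_le_mul hza (ih n) (by positivity) (by positivity)
      have hsub : ‖(X * g).coeff n - a * g.coeff n‖ ≤ max ‖(X * g).coeff n‖ ‖a * g.coeff n‖ :=
        norm_sub_le_max_of_ultrametric (((X * g).coeff n : F) : L) ((a * g.coeff n : F) : L)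
      calc _ ≤ max ‖(X * g).coeff n‖ ‖a * g.coeff n‖ * ‖z‖ ^ n := by gcongr
        _ ≤ _ := by
          rw [max_mul_of_nonneg _ _ (by positivity)]
          exact max_le hxg hag
  have hs := (IsAlgClosed.splits f).eq_prod_roots
  rw [hs, coeff_C_mul, map_mul, aeval_C, norm_mul, norm_mul, mul_assoc]
  exact mul_le_mul_of_nonneg_left (key _ n) (norm_nonneg _)

/-- Let `F` be an algebraically closed subfield containing a topologically-algebraically
independent family which has as many elements as a generating set. Then no nonzero element is
orthogonal to `F`. -/
theorem TAIndepFamily.exists_mem_norm_sub_lt [CompleteSpace L] [IsAlgClosed L] {ι : Type*}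
    [Fintype ι] {B X : Set L} (hX : X.Finite) {y : ι → L} (hy : TAIndepFamily B y)
    (hyX : ∀ i, y i ∈ tacl (B ∪ X)) (hcard : Fintype.card ι = X.ncard) {F : Subfield L}
    (hF : F.IsRelAlgClosed) (hBF : B ⊆ F) (hyF : ∀ i, y i ∈ F) {z : L} (hz : z ∈ tacl (B ∪ X))
    (hz0 : z ≠ 0) : ∃ u ∈ F, ‖z - u‖ < ‖z‖ := by
  by_contra! hcon
  have := hF.isAlgClosed
  -- An algebraic `w` this close to `z` is still orthogonal to `F`.
  obtain ⟨w, hw, hzw⟩ := exists_mem_acl_norm_sub_lt hz (norm_pos_iff.2 hz0)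
  have hwz := norm_eq_of_norm_sub_lt hzw
  have hw0 : 0 < ‖w‖ := hwz ▸ norm_pos_iff.2 hz0
  have hwF : ∀ u ∈ F, ‖w‖ ≤ ‖w - u‖ := by
    intro u hu
    by_contra! hlt
    refine absurd (hcon u hu) (not_le.2 ?_)
    rw [← sub_add_sub_cancel z w u]
    exact (IsUltrametricDist.norm_add_le_max _ _).trans_lt (max_lt hzw (hwz ▸ hlt))
  obtain ⟨y', h1, h2, h3⟩ := hy.exists_approx hyX
  have hXy := subset_acl_of_card_eq hX h2.notMem_acl h1 hcard
  have hwy : w ∈ acl (B ∪ Set.range y') := by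
    refine acl_le (isRelAlgClosed_acl _) (Set.union_subset ?_ hXy) hw
    exact Set.subset_union_left.trans (subset_acl _)
  obtain ⟨p, hp, hpc, hpw⟩ := exists_monic_of_isAlgebraic (mem_acl.1 hwy)
  obtain ⟨Φ, k1, k2, k3, k4⟩ := exists_ringHom_tacl_family h3
  have hsurj := (map_tacl_family (isClosed_tacl _) (isRelAlgClosed_tacl _)
    (subset_tacl _) k1 k2 k3 Set.univ).2.2.2
  rw [Set.image_univ, Set.image_univ] at hsurj
  choose b hb hbp using fun n => hsurj _ (hpc n)
  have hle : Subfield.closure (B ∪ Set.range y) ≤ F :=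
    Subfield.closure_le.2 (Set.union_subset hBF (by rintro _ ⟨i, rfl⟩; exact hyF i))
  -- Pulling the coefficients of `p` back along `Φ` gives `Q` over `F`. By the Gauss norm `‖Q(w)‖`
  -- dominates every `‖b n‖ * ‖w‖ ^ n`; but `Q(w) = Q(w) - p(w)` is bounded by some `‖b n - p.coeff
  -- n‖ * ‖w‖ ^ n`, which is strictly smaller.
  let Q : F[X] := ∑ n ∈ Finset.range (p.natDegree + 1), monomial n ⟨b n, hle (hb n)⟩
  have hQ (n : ℕ) (hn : n ∈ Finset.range (p.natDegree + 1)) : Q.coeff n = ⟨b n, hle (hb n)⟩ := by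
    simp only [Q, finsetSum_coeff, coeff_monomial]
    rw [Finset.sum_ite_eq' _ n, if_pos hn]
  have hgauss (n : ℕ) (hn : n ∈ Finset.range (p.natDegree + 1)) :
      ‖(b n : L)‖ * ‖w‖ ^ n ≤ ‖aeval w Q‖ := by
    have := norm_coeff_mul_pow_le_norm_aeval hwF Q n
    rw [hQ n hn] at this
    exact this
  have hpos : 0 < ‖aeval w Q‖ := by
    refine lt_of_lt_of_le ?_ (hgauss p.natDegree (by simp))
    have h0 : ‖b p.natDegree‖ = 1 := by
      rw [← k1, hbp, hp.coeff_natDegree, norm_one]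
    rw [show ‖(b p.natDegree : L)‖ = 1 from h0]
    positivity
  have hQw : aeval w Q = ∑ n ∈ Finset.range (p.natDegree + 1), ((b n : L) - p.coeff n) * w ^ n := by
    have h0 := eval_eq_sum_range (p := p) w
    rw [hpw] at h0
    rw [← sub_zero (aeval w Q), h0]
    simp only [Q, map_sum, aeval_monomial, sub_mul, Finset.sum_sub_distrib]
    rfl
  obtain ⟨n, hn, hle'⟩ := IsUltrametricDist.exists_norm_finsetSum_le_of_nonempty
    (t := Finset.range (p.natDegree + 1)) (by simp) fun n => ((b n : L) - p.coeff n) * w ^ n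
  rw [← hQw] at hle'
  refine absurd hle' (not_le.2 ?_)
  rw [norm_mul, norm_pow]
  rcases eq_or_ne (b n) 0 with h0 | h0
  · have hn0 := hbp n
    rw [h0, map_zero] at hn0
    rw [h0, ← hn0]
    simpa using hpos
  · refine lt_of_lt_of_le ?_ (hgauss n hn)
    have := k4 (b n) (hb n) h0
    rw [hbp] at this
    have : ‖(b n : L) - p.coeff n‖ < ‖(b n : L)‖ := this
    gcongr

end Immediate

/-! ### Countable generation, and Baire category for generating families. -/

section Generation

variable {L : Type*} [NormedField L]

/-- An element of the completed algebraic closure of `S ∪ T` belongs to that of `D ∪ T` for a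
countable subset `D` of `S`. -/
theorem exists_countable_mem_tacl {S T : Set L} {t : L} (ht : t ∈ tacl (S ∪ T)) :
    ∃ D : Set L, D.Countable ∧ D ⊆ S ∧ t ∈ tacl (D ∪ T) := by
  choose g hg htg using fun k : ℕ =>
    exists_mem_acl_norm_sub_lt ht (Nat.one_div_pos_of_nat (α := ℝ) (n := k))
  choose D hD1 hD2 hD3 using fun k => exists_finite_mem_acl (hg k)
  refine ⟨⋃ k, D k, Set.countable_iUnion fun k => (hD1 k).countable, Set.iUnion_subset hD2, ?_⟩
  refine Metric.mem_closure_iff.2 fun ε hε => ?_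
  obtain ⟨k, hk⟩ := exists_nat_one_div_lt hε
  refine ⟨g k, acl_mono (Set.union_subset_union_left T (Set.subset_iUnion D k)) (hD3 k), ?_⟩
  rw [dist_eq_norm]
  exact (htg k).trans hk

variable [IsUltrametricDist L] [CompleteSpace L] [IsAlgClosed L]

/-- Intermediate fields of an extension generated by a single element `x` are distinguished by
their distance to `x`. -/
theorem infDist_lt_of_notMem {E F : Subfield L} (hEc : IsClosed (E : Set L))
    (hE : E.IsRelAlgClosed) (hFc : IsClosed (F : Set L)) (hF : F.IsRelAlgClosed) (hEF : E ≤ F)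
    {x : L} (hFx : F ≤ tacl (insert x (E : Set L))) {z : L} (hzF : z ∈ F) (hzE : z ∉ E) :
    Metric.infDist x (F : Set L) < Metric.infDist x (E : Set L) := by
  have hne : (E : Set L).Nonempty := ⟨0, zero_mem E⟩
  have hxE : x ∉ E := fun hx => hzE (tacl_le hEc hE (Set.insert_subset hx subset_rfl) (hFx hzF))
  obtain ⟨ε, hε, hzε⟩ := exists_pos_le_norm_sub hEc hzE
  obtain ⟨g, hg, hzg⟩ := exists_mem_acl_norm_sub_lt (hFx hzF) hε
  have hgE : g ∉ acl (E : Set L) := fun h =>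
    absurd (hzε g (acl_le hE subset_rfl h)) (not_le.2 hzg)
  have hxg : x ∈ tacl (insert g (E : Set L)) := acl_le_tacl _ (mem_acl_exchange hg hgE)
  have hga : ∀ a ∈ E, ‖g - z‖ < ‖g - a‖ := by
    intro a ha
    have h1 := hzg.trans_le (hzε a ha)
    have h2 := norm_eq_of_norm_sub_lt (u := z - a) (u' := g - a) (by rwa [sub_sub_sub_cancel_right])
    rwa [h2, norm_sub_rev]
  obtain ⟨Φ, h1, h2, h3, -⟩ := exists_ringHom_tacl_insert hE hga
  -- By exchange `x` lies in the closure of `E` and `g`; since `Φ` fixes `E` and sends `g` to `z`,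
  -- the image `x'` falls into `F`.
  set x' := Φ ⟨x, hxg⟩ with hx'
  have hxF : x' ∈ F := by
    have := (map_tacl_family (ι := Unit) (B := (E : Set L)) (y := fun _ => g) (y' := fun _ => z)
      (isClosed_tacl _) (isRelAlgClosed_tacl _)
      (by rw [Set.range_const, Set.union_singleton]; exact subset_tacl _) h1 h2
      (fun _ => h3) Set.univ).1 ⟨x, hxg⟩
      (by rwa [Set.image_univ, Set.range_const, Set.union_singleton])
    rw [Set.image_univ, Set.range_const, Set.union_singleton] at this
    exact tacl_le hFc hF (Set.insert_subset hzF hEF) this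
  have hle : ‖x - x'‖ ≤ Metric.infDist x (E : Set L) := by
    refine (Metric.le_infDist hne).2 fun a ha => ?_
    have ha' : a ∈ tacl (insert g (E : Set L)) := subset_tacl _ (Or.inr ha)
    have h4 : ‖x' - a‖ = ‖x - a‖ := by
      have h5 := h1 (⟨x, hxg⟩ - ⟨a, ha'⟩)
      rw [map_sub, h2 ⟨a, ha'⟩ ha] at h5
      exact h5
    rw [dist_eq_norm, ← sub_sub_sub_cancel_right x x' a]
    refine (norm_sub_le_max_of_ultrametric _ _).trans ?_
    rw [h4, max_self]
  rcases eq_or_ne (x - x') 0 with h0 | h0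
  · have hxF' : x ∈ F := by rwa [sub_eq_zero.1 h0]
    rw [Metric.infDist_zero_of_mem hxF']
    exact (hEc.notMem_iff_infDist_pos hne).1 hxE
  -- Over `E` the single element `z` of `F` is independent and `x` is a single generator, so `x -
  -- x'` is not orthogonal to `F`: correcting `x'` by some `u` in `F` brings it strictly closer to
  -- `x`.
  · have hind : TAIndepFamily (E : Set L) (fun _ : Unit => z) := by
      intro i hi
      refine hzE (tacl_le hEc hE (Set.union_subset subset_rfl ?_) hi)
      rintro _ ⟨j, hj, -⟩
      exact absurd rfl hj
    obtain ⟨u, hu, hux⟩ := hind.exists_mem_norm_sub_lt (Set.finite_singleton x)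
      (fun _ => by rw [Set.union_singleton]; exact hFx hzF) (by simp) hF hEF (fun _ => hzF)
      (z := x - x') (by
        rw [Set.union_singleton]
        exact sub_mem (subset_tacl _ (Or.inl rfl)) (hFx hxF)) h0
    refine (Metric.infDist_le_dist_of_mem (add_mem hxF hu)).trans_lt ?_
    rw [dist_eq_norm, ← sub_sub]
    exact hux.trans_le hle

/-- Take countably many elements of `F` that, with `x`, yield every element of `C`, and add a
sequence in `F` whose distances to `x` tend to the infimum. The field they generate is as close to
`x` as `F`, so it cannot be smaller than `F`. -/
theorem exists_countable_generating_of_insert {B : Set L} {F : Subfield L}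
    (hFc : IsClosed (F : Set L)) (hF : F.IsRelAlgClosed) (hBF : B ⊆ F) {x : L}
    (h : ∃ C : Set L, C.Countable ∧ tacl (B ∪ C) = tacl (insert x (F : Set L))) :
    ∃ C : Set L, C.Countable ∧ tacl (B ∪ C) = F := by
  obtain ⟨C, hC, hCx⟩ := h
  have hmem (t : C) : (t : L) ∈ tacl ((F : Set L) ∪ {x}) := by
    rw [Set.union_singleton, ← hCx]
    exact subset_tacl _ (Or.inr t.2)
  choose D hD1 hD2 hD3 using fun t : C => exists_countable_mem_tacl (hmem t)
  have hne : (F : Set L).Nonempty := ⟨0, zero_mem F⟩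
  choose w hwF hw using fun k : ℕ => (Metric.infDist_lt_iff (x := x) hne).1
    (lt_add_of_pos_right (Metric.infDist x (F : Set L)) (Nat.one_div_pos_of_nat (α := ℝ) (n := k)))
  have := hC.to_subtype
  refine ⟨(⋃ t, D t) ∪ Set.range w, (Set.countable_iUnion hD1).union (Set.countable_range w), ?_⟩
  set E := tacl (B ∪ ((⋃ t, D t) ∪ Set.range w)) with hE
  have hEF : E ≤ F := by
    refine tacl_le hFc hF (Set.union_subset hBF (Set.union_subset (Set.iUnion_subset hD2) ?_))
    rintro _ ⟨k, rfl⟩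
    exact hwF k
  by_contra hne'
  obtain ⟨z, hzF, hzE⟩ := SetLike.exists_of_lt (lt_of_le_of_ne hEF hne')
  have hFE : F ≤ tacl (insert x (E : Set L)) := by
    refine fun a ha => ?_
    have h1 : a ∈ tacl (B ∪ C) := by
      rw [hCx]
      exact subset_tacl _ (Or.inr ha)
    refine tacl_le_tacl (Set.union_subset (fun b hb => ?_) fun t ht => ?_) h1
    · exact subset_tacl _ (Or.inr (subset_tacl _ (Or.inl hb)))
    · refine tacl_mono (Set.union_subset ?_ ?_) (hD3 ⟨t, ht⟩)
      · exact fun d hd => Or.inr (subset_tacl _ (Or.inr (Or.inl (Set.mem_iUnion.2 ⟨_, hd⟩))))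
      · exact fun d hd => Or.inl hd
  have hlt := infDist_lt_of_notMem (isClosed_tacl _) (isRelAlgClosed_tacl _) hFc hF hEF hFE hzF hzE
  obtain ⟨k, hk⟩ := exists_nat_one_div_lt (sub_pos.2 hlt)
  have h1 : Metric.infDist x (E : Set L) ≤ dist x (w k) :=
    Metric.infDist_le_dist_of_mem (subset_tacl _ (Or.inr (Or.inr ⟨k, rfl⟩)))
  linarith [hw k]

/-- A closed algebraically closed subfield of a countably generated field is countably generated
if the latter is finitely generated over the former. -/
theorem exists_countable_generating {B : Set L} {F : Subfield L}
    (hFc : IsClosed (F : Set L)) (hF : F.IsRelAlgClosed) (hBF : B ⊆ F) {S : Set L} (hS : S.Finite)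
    (h : ∃ C : Set L, C.Countable ∧ tacl (B ∪ C) = tacl ((F : Set L) ∪ S)) :
    ∃ C : Set L, C.Countable ∧ tacl (B ∪ C) = F := by
  induction S, hS using Set.Finite.induction_on with
  | empty => rwa [Set.union_empty, tacl_eq_self hFc hF] at h
  | @insert s S _ _ ih =>
    refine ih (exists_countable_generating_of_insert (isClosed_tacl _) (isRelAlgClosed_tacl _)
      (x := s) ?_ ?_)
    · exact hBF.trans (Set.subset_union_left.trans (subset_tacl _))
    · rwa [Set.union_insert, ← Set.union_singleton, ← tacl_tacl_union, Set.union_singleton] at h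

-- Semicontinuity: the lower limit of the closures as `w'` tends to `w` is closed, relatively
-- algebraically closed and contains `B` and `w`, hence contains the closure at `w`.
omit [IsUltrametricDist L] [CompleteSpace L] in
theorem isOpen_setOf_exists_mem_tacl_norm_sub_lt {ι : Type*} [Finite ι] (B : Set L)
    (F : Subfield L) (c : L) (ε : ℝ) :
    IsOpen {w : ι → F | ∃ u ∈ tacl (B ∪ Set.range fun i => (w i : L)), ‖c - u‖ < ε} := by
  rw [isOpen_iff_mem_nhds]
  rintro w ⟨u, hu, hcu⟩
  have hle : tacl (B ∪ Set.range fun i => (w i : L)) ≤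
      Subfield.limInf (𝓝 w) fun w' => tacl (B ∪ Set.range fun i => (w' i : L)) := by
    refine tacl_le Subfield.isClosed_limInf
      (Subfield.isRelAlgClosed_limInf fun _ => isRelAlgClosed_tacl _) (Set.union_subset ?_ ?_)
    · exact fun b hb U hU => Eventually.of_forall fun w' =>
        ⟨b, subset_tacl _ (Or.inl hb), mem_of_mem_nhds hU⟩
    · rintro _ ⟨i, rfl⟩ U hU
      have hcont : Continuous fun w' : ι → F => (w' i : L) := by fun_prop
      filter_upwards [hcont.continuousAt.preimage_mem_nhds hU] with w' hw'
      exact ⟨_, subset_tacl _ (Or.inr ⟨i, rfl⟩), hw'⟩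
  have hball : Metric.ball c ε ∈ 𝓝 u := by
    refine Metric.isOpen_ball.mem_nhds ?_
    rwa [Metric.mem_ball, dist_comm, dist_eq_norm]
  filter_upwards [hle hu _ hball] with w' hw'
  obtain ⟨b, hb, hbc⟩ := hw'
  exact ⟨b, hb, by rwa [← dist_eq_norm, dist_comm]⟩

theorem isOpen_setOf_tAIndepFamily {ι : Type*} [Fintype ι] (B : Set L) (F : Subfield L) :
    IsOpen {w : ι → F | TAIndepFamily B fun i => (w i : L)} := by
  rw [Metric.isOpen_iff]
  intro w hw
  obtain ⟨δ, hδ, h⟩ := TAIndepFamily.exists_pos hw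
  refine ⟨δ, hδ, fun w' hw' => TAIndepFamily.of_near hw (h _ fun i => ?_)⟩
  rw [Metric.mem_ball, dist_comm] at hw'
  exact (dist_eq_norm (w i : L) (w' i : L)) ▸ (dist_le_pi_dist w w' i).trans_lt hw'

omit [IsUltrametricDist L] [CompleteSpace L] [IsAlgClosed L] in
/-- In a field all of whose topologically-algebraically independent families have at most `ι`
elements, independent families indexed by `ι` can be moved slightly so as to generate a given
element. -/
theorem TAIndepFamily.exists_near_mem_tacl {ι : Type*} [Fintype ι] {B : Set L} {F : Subfield L}
    (hF : F.IsRelAlgClosed) (hBF : B ⊆ F)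
    (hmax : ∀ z : Option ι → L, (∀ o, z o ∈ F) → ¬ TAIndepFamily B z) {w : ι → F}
    (hw : TAIndepFamily B fun i => (w i : L)) {c : L} (hc : c ∈ F) {δ : ℝ} (hδ : 0 < δ) :
    ∃ w' : ι → F, dist w' w < δ ∧ c ∈ tacl (B ∪ Set.range fun i => (w' i : L)) := by
  classical
  by_cases hcw : c ∈ tacl (B ∪ Set.range fun i => (w i : L))
  · exact ⟨w, by rwa [dist_self], hcw⟩
  let z : Option ι → L := fun o => o.elim c fun i => w i
  have hz := hmax z (by rintro (_ | i); exacts [hc, (w i).2])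
  simp only [TAIndepFamily, not_forall, not_not] at hz
  -- The enlarged family fails to be independent at some index. The index of `c` is excluded by
  -- `hcw`, so some `w j` depends on `c` and the remaining members.
  obtain ⟨_ | j, hj⟩ := hz
  · refine absurd (tacl_mono (Set.union_subset_union_right B ?_) hj) hcw
    rintro _ ⟨_ | i, hi, rfl⟩
    · exact absurd rfl hi
    · exact ⟨i, rfl⟩
  set S := B ∪ (fun i => (w i : L)) '' {j}ᶜ with hS
  have hjS : (w j : L) ∈ tacl (insert c S) := by
    refine tacl_mono ?_ hj
    rintro _ (hb | ⟨_ | i, hi, rfl⟩)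
    · exact Or.inr (Or.inl hb)
    · exact Or.inl rfl
    · exact Or.inr (Or.inr ⟨i, fun h => hi (by rw [Set.mem_singleton_iff.1 h]; rfl), rfl⟩)
  obtain ⟨ε, hε, hjε⟩ := exists_pos_le_norm_sub (isClosed_tacl S) (hw j)
  -- The approximation `g` of `w j` is algebraic over `c` and `S` but not over `S`, so algebraic
  -- exchange recovers `c` once `w j` is replaced by `g`.
  obtain ⟨g, hg, hjg⟩ := exists_mem_acl_norm_sub_lt hjS (lt_min hε hδ)
  have hgS : g ∉ acl S := fun h =>
    absurd (hjε g (acl_le_tacl S h)) (not_le.2 (hjg.trans_le (min_le_left _ _)))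
  have hgF : g ∈ F := by
    refine acl_le hF (Set.insert_subset hc (Set.union_subset hBF ?_)) hg
    rintro _ ⟨i, -, rfl⟩
    exact (w i).2
  refine ⟨Function.update w j ⟨g, hgF⟩, ?_, ?_⟩
  · refine (dist_pi_lt_iff hδ).2 fun i => ?_
    rcases eq_or_ne i j with rfl | hij
    · rw [Function.update_self, Subtype.dist_eq, dist_comm, dist_eq_norm]
      exact hjg.trans_le (min_le_right _ _)
    · rwa [Function.update_of_ne hij, dist_self]
  · refine acl_le_tacl _ (acl_mono ?_ (mem_acl_exchange hg hgS))
    rintro _ (rfl | hb | ⟨i, hi, rfl⟩)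
    · exact Or.inr ⟨j, by simp⟩
    · exact Or.inl hb
    · exact Or.inr ⟨i, by simp [Function.update_of_ne hi]⟩

/-- A countably generated field is generated by some topologically-algebraically independent
family of maximal finite cardinality. -/
theorem exists_tAIndepFamily_generating {ι : Type*} [Fintype ι] {B C : Set L} (hC : C.Countable)
    {F : Subfield L} (hF : tacl (B ∪ C) = F)
    (hmax : ∀ z : Option ι → L, (∀ o, z o ∈ F) → ¬ TAIndepFamily B z) {y : ι → L}
    (hyF : ∀ i, y i ∈ F) (hy : TAIndepFamily B y) :
    ∃ w : ι → L, TAIndepFamily B w ∧ tacl (B ∪ Set.range w) = F := by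
  have hFc : IsClosed (F : Set L) := hF ▸ isClosed_tacl _
  have hFr : F.IsRelAlgClosed := hF ▸ isRelAlgClosed_tacl _
  have hBCF : B ∪ C ⊆ F := hF ▸ subset_tacl _
  have : CompleteSpace F := hFc.completeSpace_coe
  have := hC.to_subtype
  set Ω := {w : ι → F | TAIndepFamily B fun i => (w i : L)} with hΩ
  have hΩo : IsOpen Ω := isOpen_setOf_tAIndepFamily B F
  have hΩne : Ω.Nonempty := ⟨fun i => ⟨y i, hyF i⟩, hy⟩
  -- A family lying in every `U q` has all of `C` in its completed closure.
  let U (q : C × ℕ) : Set (ι → F) :=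
    {w | ∃ u ∈ tacl (B ∪ Set.range fun i => (w i : L)), ‖(q.1 : L) - u‖ < 1 / ((q.2 : ℝ) + 1)}
  have hUΩ (q : C × ℕ) : Ω ⊆ closure (U q) := by
    intro w hw
    refine Metric.mem_closure_iff.2 fun δ hδ => ?_
    obtain ⟨w', h1, h2⟩ := TAIndepFamily.exists_near_mem_tacl hFr
      (Set.subset_union_left.trans hBCF) hmax hw (hBCF (Or.inr q.1.2)) hδ
    exact ⟨w', ⟨_, h2, by rw [sub_self, norm_zero]; exact Nat.one_div_pos_of_nat⟩,
      by rwa [dist_comm]⟩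
  -- Each `U q` is only known to be dense along `Ω`. Adding the exterior of `Ω` makes it dense
  -- everywhere, and intersecting with `Ω` afterwards discards that part.
  have hdense := dense_iInter_of_isOpen (f := fun q => U q ∪ (closure Ω)ᶜ)
    (fun q => (isOpen_setOf_exists_mem_tacl_norm_sub_lt B F q.1 _).union
      isClosed_closure.isOpen_compl) (fun q w => by
      by_cases hw : w ∈ closure Ω
      · exact closure_mono Set.subset_union_left (closure_minimal (hUΩ q) isClosed_closure hw)
      · exact subset_closure (Or.inr hw))
  obtain ⟨w, hwΩ, hw⟩ := hdense.inter_open_nonempty Ω hΩo hΩne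
  refine ⟨fun i => w i, hwΩ, le_antisymm ?_ ?_⟩
  · refine tacl_le hFc hFr (Set.union_subset (Set.subset_union_left.trans hBCF) ?_)
    rintro _ ⟨i, rfl⟩
    exact (w i).2
  · refine hF.symm.le.trans (tacl_le_tacl
      (Set.union_subset (Set.subset_union_left.trans (subset_tacl _)) ?_))
    intro c hc
    refine (isClosed_tacl _).closure_subset (Metric.mem_closure_iff.2 fun ε hε => ?_)
    obtain ⟨k, hk⟩ := exists_nat_one_div_lt hε
    rcases Set.mem_iInter.1 hw (⟨c, hc⟩, k) with ⟨u, hu, hcu⟩ | h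
    · exact ⟨u, hu, by rw [dist_eq_norm]; exact hcu.trans hk⟩
    · exact absurd (subset_closure hwΩ) h

end Generation

/-! ### Degrees expressed through independent families. -/

section Degree

universe u v

variable {K : Type u} {L : Type v} [NormedField K] [NormedField L] [NormedAlgebra K L]

namespace TAIndepFamily

theorem injective {ι : Type*} {B : Set L} {y : ι → L} (hy : TAIndepFamily B y) :
    Function.Injective y := by
  intro i j hij
  by_contra hne
  exact hy i (subset_tacl _ (Or.inr ⟨j, fun h => hne h.symm, hij.symm⟩))

theorem comp {ι κ : Type*} {B : Set L} {y : ι → L} (hy : TAIndepFamily B y) {f : κ → ι}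
    (hf : Function.Injective f) : TAIndepFamily B (y ∘ f) := by
  intro k hk
  refine hy (f k) (tacl_mono (Set.union_subset_union_right B ?_) hk)
  rintro _ ⟨l, hl, rfl⟩
  exact ⟨f l, fun h => hl (hf h), rfl⟩

theorem tAIndependent {ι : Type*} {y : ι → L}
    (hy : TAIndepFamily (Set.range (algebraMap K L)) y) : TAIndependent K (Set.range y) := by
  intro S' hS'
  rw [taClosure_eq_tacl, taClosure_eq_tacl]
  refine lt_of_le_not_ge (tacl_mono (Set.union_subset_union_right _ hS'.subset)) fun hle => ?_
  obtain ⟨_, ⟨i, rfl⟩, hi⟩ := Set.exists_of_ssubset hS'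
  refine hy i (tacl_mono (Set.union_subset_union_right _ ?_)
    (hle (subset_tacl _ (Or.inr ⟨i, rfl⟩))))
  intro s hs
  obtain ⟨j, rfl⟩ := hS'.subset hs
  exact ⟨j, fun h => hi (by rwa [← Set.mem_singleton_iff.1 h]), rfl⟩

end TAIndepFamily

/-- A member in the closure of the others could be removed without shrinking the closure. -/
theorem TAIndependent.tAIndepFamily [IsAlgClosed L] {S : Set L} (hS : TAIndependent K S) :
    TAIndepFamily (Set.range (algebraMap K L)) (Subtype.val : S → L) := by
  intro s hs
  have hsub : (Subtype.val : S → L) '' {s}ᶜ ⊂ S := by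
    refine Set.ssubset_iff_exists.2 ⟨Subtype.coe_image_subset S _, s, s.2, ?_⟩
    rintro ⟨t, ht, hts⟩
    exact ht (Subtype.ext hts)
  have := hS _ hsub
  rw [taClosure_eq_tacl, taClosure_eq_tacl] at this
  refine not_le_of_gt this (tacl_le_tacl (Set.union_subset ?_ fun t ht => ?_))
  · exact Set.subset_union_left.trans (subset_tacl _)
  · by_cases hts : (⟨t, ht⟩ : S) = s
    · subst hts
      exact hs
    · exact subset_tacl _ (Or.inr ⟨⟨t, ht⟩, hts, rfl⟩)

theorem TAIndependent.mk_le_topTrdeg {S : Set L} (hS : TAIndependent K S) : #S ≤ topTrdeg K L :=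
  le_ciSup (f := fun S : {S : Set L // TAIndependent K S} => #(S : Set L))
    Cardinal.bddAbove_of_small ⟨S, hS⟩

theorem TAIndepFamily.map {L₁ L₂ ι : Type*} [NormedField L₁] [NormedField L₂] [NormedAlgebra K L₁]
    [NormedAlgebra K L₂] [CompleteSpace L₁] [IsAlgClosed L₁] [IsAlgClosed L₂] {y : ι → L₁}
    (hy : TAIndepFamily (Set.range (algebraMap K L₁)) y) (φ : L₁ →ₐ[K] L₂)
    (hφ : ∀ x, ‖φ x‖ = ‖x‖) : TAIndepFamily (Set.range (algebraMap K L₂)) (φ ∘ y) := by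
  intro i hi
  have h1 : Set.range (algebraMap K L₂) ∪ (φ ∘ y) '' {i}ᶜ =
      (φ : L₁ →+* L₂) '' (Set.range (algebraMap K L₁) ∪ y '' {i}ᶜ) := by
    rw [Set.image_union, ← Set.range_comp, Set.image_comp]
    congr 2
    ext x
    exact (φ.commutes x).symm
  rw [h1, ← map_tacl (Φ := (φ : L₁ →+* L₂)) hφ] at hi
  obtain ⟨x, hx, hxi⟩ := hi
  rw [(φ : L₁ →+* L₂).injective hxi] at hx
  exact hy i hx

theorem topTrdeg_le_of_algHom {L₁ L₂ : Type v} [NormedField L₁] [NormedField L₂]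
    [NormedAlgebra K L₁] [NormedAlgebra K L₂] [CompleteSpace L₁] [IsAlgClosed L₁] [IsAlgClosed L₂]
    (φ : L₁ →ₐ[K] L₂) (hφ : ∀ x, ‖φ x‖ = ‖x‖) : topTrdeg K L₁ ≤ topTrdeg K L₂ := by
  refine ciSup_le' fun S => ?_
  have h := S.2.tAIndepFamily.map φ hφ
  have := h.tAIndependent.mk_le_topTrdeg
  rwa [Cardinal.mk_range_eq _ h.injective] at this

variable [IsAlgClosed L]

/-- A natural number bounds a cardinal once it bounds all finite subsets, so the count for finite
families suffices. -/
theorem TAIndependent.mk_le_ncard [IsUltrametricDist L] [CompleteSpace L] {S X : Set L}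
    (hS : TAIndependent K S) (hX : X.Finite)
    (hgen : tacl (Set.range (algebraMap K L) ∪ X) = ⊤) : #S ≤ X.ncard := by
  rw [Cardinal.mk_le_iff_forall_finset_subset_card_le]
  intro t ht
  have h := hS.tAIndepFamily.comp (Set.inclusion_injective ht)
  have := h.card_le hX fun i => by rw [hgen]; exact Subfield.mem_top _
  simpa using this

/-- A small extension has a finite topologically-algebraically independent generating set. -/
theorem IsSmallExtension.exists_generating (h : IsSmallExtension K L) : ∃ X : Set L, X.Finite ∧
    tacl (Set.range (algebraMap K L) ∪ X) = ⊤ ∧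
    TAIndepFamily (Set.range (algebraMap K L)) (Subtype.val : X → L) := by
  have hne : Nonempty {S : Set L // TAGenerating K S} :=
    ⟨⟨Set.univ, top_le_iff.1 fun x _ => subset_tacl _ (Or.inr (Set.mem_univ x))⟩⟩
  obtain ⟨⟨X, hX⟩, hXd⟩ :=
    ciInf_mem fun S : {S : Set L // TAGenerating K S} => #(S : Set L)
  have hXd' : #X = topGenDeg K L := hXd
  have hfin : X.Finite := by
    rw [← Cardinal.lt_aleph0_iff_set_finite, hXd']
    exact h
  refine ⟨X, hfin, hX, fun x hx => ?_⟩
  have himg : (Subtype.val : X → L) '' {x}ᶜ = X \ {(x : L)} := by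
    rw [Set.compl_eq_univ_sdiff, Set.image_sdiff Subtype.val_injective, Set.image_univ,
      Subtype.range_coe, Set.image_singleton]
  rw [himg] at hx
  -- Dropping a dependent `x` would leave a smaller generating set, against the minimality of `X`.
  have hgen : TAGenerating K (X \ {(x : L)}) := by
    refine top_le_iff.1 ((ge_of_eq hX).trans (tacl_le_tacl (Set.union_subset ?_ fun t ht => ?_)))
    · exact Set.subset_union_left.trans (subset_tacl _)
    · by_cases htx : t = x
      · rwa [htx]
      · exact subset_tacl _ (Or.inr ⟨ht, htx⟩)
  have hle : topGenDeg K L ≤ #(X \ {(x : L)} : Set L) :=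
    ciInf_le' (fun S : {S : Set L // TAGenerating K S} => #(S : Set L)) ⟨_, hgen⟩
  rw [← hXd', ← Set.cast_ncard hfin, ← Set.cast_ncard hfin.sdiff, Nat.cast_le] at hle
  exact absurd hle (not_le.2 (Set.ncard_sdiff_singleton_lt_of_mem x.2 hfin))

theorem topTrdeg_eq_ncard [IsUltrametricDist L] [CompleteSpace L] {X : Set L} (hX : X.Finite)
    (hgen : tacl (Set.range (algebraMap K L) ∪ X) = ⊤)
    (hind : TAIndepFamily (Set.range (algebraMap K L)) (Subtype.val : X → L)) :
    topTrdeg K L = X.ncard := by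
  refine le_antisymm (ciSup_le' fun S => S.2.mk_le_ncard hX hgen) ?_
  have := hind.tAIndependent.mk_le_topTrdeg
  rwa [Subtype.range_coe, ← Set.cast_ncard hX] at this

omit [IsAlgClosed L] in
/-- A finite topological transcendence degree is attained. -/
theorem exists_mk_eq_topTrdeg {n : ℕ} (h : topTrdeg K L = n) :
    ∃ S : Set L, TAIndependent K S ∧ #S = n := by
  by_contra! hcon
  have hlt (S : Set L) (hS : TAIndependent K S) : #S < n :=
    lt_of_le_of_ne (h ▸ hS.mk_le_topTrdeg) (hcon S hS)
  -- Cardinals below `n + 1` are at most `n`, so an unattained supremum would be too small; in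
  -- degree 0 the empty set attains it.
  cases n with
  | zero =>
    have hempty : TAIndependent K (∅ : Set L) := fun S' hS' =>
      (hS'.2 (Set.empty_subset S')).elim
    simpa using hlt ∅ hempty
  | succ n =>
    have : topTrdeg K L ≤ n := ciSup_le' fun S => by
      have := hlt S S.2
      rwa [Nat.cast_succ, Cardinal.lt_natCast_add_one_iff] at this
    rw [h, Nat.cast_le] at this
    omega

end Degree

/-! ### Immediacy from the absence of orthogonal elements. -/

section Immediate

variable {L : Type*} [NormedField L] [IsUltrametricDist L]

theorem norm_le_one_of_mem_valuationSubring
    (x : (NormedField.valuation (K := L)).valuationSubring) : ‖(x : L)‖ ≤ 1 := x.2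

theorem residue_eq_of_norm_sub_lt {x y : (NormedField.valuation (K := L)).valuationSubring}
    (h : ‖(x : L) - y‖ < 1) : IsLocalRing.residue _ x = IsLocalRing.residue _ y := by
  rw [← sub_eq_zero, ← map_sub, IsLocalRing.residue_eq_zero_iff, IsLocalRing.mem_maximalIdeal,
    mem_nonunits_iff]
  intro hu
  obtain ⟨z, hz⟩ := hu.exists_right_inv
  have h1 : ‖((x : L) - y) * z‖ = 1 := by
    rw [show ((x : L) - y) * z = 1 from congrArg Subtype.val hz, norm_one]
  rw [norm_mul] at h1
  have := mul_lt_one_of_nonneg_of_lt_one_left (norm_nonneg _) h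
    (norm_le_one_of_mem_valuationSubring z)
  linarith

/-- An extension of ultrametric fields without nonzero orthogonal elements is immediate. -/
theorem isImmediateExtension_of_exists_norm_sub_lt {E : Type*} [NormedField E]
    [IsUltrametricDist E] [NormedAlgebra E L]
    (h : ∀ z : L, z ≠ 0 → ∃ u : E, ‖z - algebraMap E L u‖ < ‖z‖) : IsImmediateExtension E L := by
  refine ⟨?_, RingHom.injective _, fun r => ?_⟩
  · ext r
    constructor
    · rintro ⟨x, hx, rfl⟩
      obtain ⟨u, hu⟩ := h x hx
      have hn := norm_eq_of_norm_sub_lt hu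
      rw [norm_algebraMap'] at hn
      exact ⟨u, norm_ne_zero_iff.1 (hn ▸ norm_ne_zero_iff.2 hx), hn⟩
    · rintro ⟨x, hx, rfl⟩
      exact ⟨algebraMap E L x, (_root_.map_ne_zero _).2 hx, norm_algebraMap' L x⟩
  · obtain ⟨z, rfl⟩ := IsLocalRing.residue_surjective r
    obtain ⟨u, hu1, hu⟩ : ∃ u : E, ‖u‖ ≤ 1 ∧ ‖algebraMap E L u - z‖ < 1 := by
      rcases (norm_le_one_of_mem_valuationSubring z).lt_or_eq with hz | hz
      · exact ⟨0, by simp, by simpa using hz⟩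
      · obtain ⟨u, hu⟩ := h z (norm_ne_zero_iff.1 (by rw [hz]; exact one_ne_zero))
        have hn := norm_eq_of_norm_sub_lt hu
        rw [norm_algebraMap', hz] at hn
        exact ⟨u, hn.le, by rwa [norm_sub_rev, ← hz]⟩
    refine ⟨IsLocalRing.residue _ ⟨u, hu1⟩, ?_⟩
    exact residue_eq_of_norm_sub_lt
      (x := algebraMap (NormedField.valuation (K := E)).valuationSubring _ ⟨u, hu1⟩) hu

end Immediate

/-! ### The isomorphism and the theorem. -/

section Main

variable {K L : Type*} [NormedField K] [NormedField L] [NormedAlgebra K L]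
    [IsUltrametricDist L] [CompleteSpace L] [IsAlgClosed L]

/-- Fields generated by independent families, the second of which has as many elements as a
generating set of `L`, are isomorphic to `L`. -/
theorem analyticIsomorphic_of_generating {ι : Type*} [Fintype ι] {X : Set L} (hX : X.Finite)
    (hgen : tacl (Set.range (algebraMap K L) ∪ X) = ⊤) (hcard : Fintype.card ι = X.ncard)
    {w : ι → L} (hw : TAIndepFamily (Set.range (algebraMap K L)) w) {F : IntermediateField K L}
    (hF : tacl (Set.range (algebraMap K L) ∪ Set.range w) = F.toSubfield) :
    AnalyticIsomorphic K F L := by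
  set B := Set.range (algebraMap K L) with hB
  obtain ⟨w', h1, h2, h3⟩ := hw.exists_approx (S := B ∪ X) fun i => by
    rw [hgen]; exact Subfield.mem_top _
  -- `w'` is independent, algebraic over `B ∪ X` and has `X.ncard` members, so `X` is algebraic over
  -- `B ∪ Set.range w'` and `w'` generates `L`. The map moving `w` to `w'` is therefore onto.
  have hXw := subset_acl_of_card_eq hX h2.notMem_acl h1 hcard
  have hw' : tacl (B ∪ Set.range w') = ⊤ := by
    refine top_le_iff.1 (hgen.symm.le.trans (tacl_le_tacl (Set.union_subset ?_ ?_)))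
    · exact Set.subset_union_left.trans (subset_tacl _)
    · exact hXw.trans (acl_le_tacl _)
  obtain ⟨Φ, k1, k2, k3, -⟩ := exists_ringHom_tacl_family h3
  have hsurj := (map_tacl_family (isClosed_tacl _) (isRelAlgClosed_tacl _)
    (subset_tacl _) k1 k2 k3 Set.univ).2.1
  rw [Set.image_univ, Set.image_univ, hw'] at hsurj
  let φ : F →ₐ[K] L :=
    { Φ.comp (Subfield.inclusion hF.symm.le) with
      commutes' := fun a => k2 ⟨algebraMap K L a, _⟩ ⟨a, rfl⟩ }
  have hφ (x : F) : ‖φ x‖ = ‖x‖ := k1 _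
  refine ⟨AlgEquiv.ofBijective φ ⟨φ.toRingHom.injective, fun z => ?_⟩, hφ⟩
  obtain ⟨x, hx, hxz⟩ := hsurj z (Subfield.mem_top z)
  exact ⟨⟨x, hF.le hx⟩, hxz⟩

end Main

end

theorem mainTheorem8 {K : Type*} {L : Type*} [NormedField K] [NormedField L] [NormedAlgebra K L]
    [IsUltrametricDist K] [IsUltrametricDist L] [CompleteSpace K] [CompleteSpace L]
    [IsAlgClosed K] [IsAlgClosed L] (hsmall : IsSmallExtension K L)
    (F : IntermediateField K L) [CompleteSpace F] [IsAlgClosed F] :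
    topTrdeg K F ≤ topTrdeg K L ∧
    (AnalyticIsomorphic K F L ↔ topTrdeg K F = topTrdeg K L) ∧
    (topTrdeg K F = topTrdeg K L → IsImmediateExtension F L) := by
  obtain ⟨X, hX, hgen, hind⟩ := hsmall.exists_generating
  have hdeg := topTrdeg_eq_ncard hX hgen hind
  have hle : topTrdeg K F ≤ topTrdeg K L := topTrdeg_le_of_algHom F.val fun x => rfl
  have hFc : IsClosed (F.toSubfield : Set L) :=
    (completeSpace_coe_iff_isComplete.1 ‹CompleteSpace F›).isClosed
  have : IsAlgClosed F.toSubfield := ‹IsAlgClosed F›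
  have hFr : F.toSubfield.IsRelAlgClosed := Subfield.isRelAlgClosed_of_isAlgClosed
  have hBF : Set.range (algebraMap K L) ⊆ F.toSubfield := by
    rintro _ ⟨a, rfl⟩
    exact F.algebraMap_mem a
  have hmem (z : L) : z ∈ tacl (Set.range (algebraMap K L) ∪ X) := hgen ▸ Subfield.mem_top z
  have key (h : topTrdeg K F = topTrdeg K L) : ∃ (S : Set F) (_ : Fintype S),
      Fintype.card S = X.ncard ∧
      TAIndepFamily (Set.range (algebraMap K L)) fun s : S => ((s : F) : L) := by
    obtain ⟨S, hS, hScard⟩ := exists_mk_eq_topTrdeg (h.trans hdeg)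
    have hSfin : S.Finite := by
      rw [← Cardinal.lt_aleph0_iff_set_finite, hScard]
      exact Cardinal.natCast_lt_aleph0
    refine ⟨S, hSfin.fintype, ?_, hS.tAIndepFamily.map F.val fun x => rfl⟩
    let _ := hSfin.fintype
    rw [Cardinal.mk_fintype] at hScard
    exact_mod_cast hScard
  refine ⟨hle, ⟨?_, fun h => ?_⟩, fun h => ?_⟩
  · rintro ⟨φ, hφ⟩
    refine le_antisymm hle (topTrdeg_le_of_algHom (φ.symm : L →ₐ[K] F) fun x => ?_)
    have := hφ (φ.symm x)
    rw [φ.apply_symm_apply] at this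
    exact this.symm
  · obtain ⟨S, _, hcard, hy⟩ := key h
    -- `L` is generated by the finite `X` over `K`, hence also over `F`, so countable generation
    -- descends to `F`.
    obtain ⟨C, hC, hCF⟩ := exists_countable_generating (B := Set.range (algebraMap K L)) hFc hFr
      hBF hX ⟨X, hX.countable, by
        refine le_antisymm (tacl_mono (Set.union_subset_union_left X hBF)) ?_
        rw [hgen]
        exact le_top⟩
    have hmax (z : Option S → L) (_ : ∀ o, z o ∈ F.toSubfield) :
        ¬ TAIndepFamily (Set.range (algebraMap K L)) z := by
      intro hz
      have := hz.card_le hX fun o => hmem _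
      rw [Fintype.card_option, hcard] at this
      omega
    obtain ⟨w, hw, hwF⟩ := exists_tAIndepFamily_generating hC hCF hmax
      (fun s : S => (s : F).2) hy
    exact analyticIsomorphic_of_generating hX hgen hcard hw hwF
  · obtain ⟨S, _, hcard, hy⟩ := key h
    refine isImmediateExtension_of_exists_norm_sub_lt fun z hz => ?_
    obtain ⟨u, hu, hzu⟩ := hy.exists_mem_norm_sub_lt hX (fun _ => hmem _) hcard hFr hBF
      (fun s => (s : F).2) (hmem z) hz
    exact ⟨⟨u, hu⟩, hzu⟩
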